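/- Let $N \ge 1$ be an integer and $s > 0$ a real number, and put $2_\# := 2 + \frac{4s}{N}$, $2^* := \frac{2N}{N-2s}$ if $N > 2s$, and $\alpha_N := \frac{N (2\pi)^N}{\omega_{N-1}}$, where $\omega_{N-1}$ is the $(N-1)$-dimensional measure of the unit sphere of $\mathbb{R}^N$. Let $f \colon \mathbb{R} \to \mathbb{R}$ be continuous, put $F(t) := \int_0^t f(r) \, \mathrm{d}r$, and assume (f1): - if $N < 2s$, there is $C > 0$ such that $|f(t)| \le C |t|$ for all $t \in [-1,1]$; - if $N = 2s$, then for every $q \ge 2$ and every $\alpha > \alpha_N$ there is $C > 0$ such that $|f(t)| \le C \bigl( |t| + |t|^{q-1} (e^{\alpha t^2} - 1) \bigr)$ for all $t \in \mathbb{R}$; - if $N > 2s$, there is $C > 0$ such that $|f(t)| \le C \bigl( |t| + |t|^{2^*-1} \bigr)$ for all $t \in \mathbb{R}$. Let $H^s(\mathbb{R}^N)$ be the space of real-valued $u \in L^2(\mathbb{R}^N)$ with $\int_{\mathbb{R}^N} |\xi|^{2s} |\mathcal{F}(u)|^2 \, \mathrm{d}\xi < +\infty$, where $\mathcal{F}$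 is the Fourier transform. For $u \in H^s(\mathbb{R}^N)$ let $$J(u) := \frac12 \int_{\mathbb{R}^N} |\mathrm{D}^s u|^2 \, \mathrm{d}x - \int_{\mathbb{R}^N} F(u) \, \mathrm{d}x,$$ where $\mathrm{D}^s u := \Delta^{s/2} u$ if $s$ is an even integer, $\mathrm{D}^s u := \nabla \Delta^{(s-1)/2} u$ if $s$ is an odd integer, and $\mathrm{D}^s u := (-\Delta)^{s/2 - \lfloor s/2 \rfloor} (-\Delta)^{\lfloor s/2 \rfloor} u$ if $s$ is not an integer; here, for $0 < \sigma < 1$, $(-\Delta)^\sigma$ is the Fourier multiplier with symbol $|\xi|^{2\sigma}$ (with $\mathcal{F}$ normalised so that $-\Delta$ has symbol $|\xi|^2$). For $\rho > 0$ let $$\mathcal{D}_0(\rho) := \Bigl\{ u \in H^s(\mathbb{R}^N) : \int_{\mathbb{R}^N} u^2 \, \mathrm{d}x \le \rho \Bigr\}, \qquad m_0(\rho) := \inf_{\mathcal{D}_0(\rho)} J \in [-\infty, +\infty),$$ and let $\rho_{*,0} := \inf \{ \rho > 0 : m_0(\rho) < 0 \}$, with $\inf \emptyset = +\infty$. Assume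 $0 < \rho_{*,0} < +\infty$. If either $2_\# F(t) < f(t) t$ for all $t \in \mathbb{R} \setminus \{0\}$, or $f(t) t < 2_\# F(t)$ for all $t \in \mathbb{R} \setminus \{0\}$, then no nontrivial minimiser of $J|_{\mathcal{D}_0(\rho_{*,0})}$ exists, i.e. there is no $u \in \mathcal{D}_0(\rho_{*,0}) \setminus \{0\}$ such that $J(u) \le J(v)$ for all $v \in \mathcal{D}_0(\rho_{*,0})$. -/

import Mathlib

open MeasureTheory
open scoped SchwartzMap FourierTransform Laplacian LineDeriv

noncomputable section

namespace MassCritical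

/-- The Euclidean space `ℝ^N`. -/
abbrev Eucl (N : ℕ) : Type := EuclideanSpace ℝ (Fin N)

/-- The real Hilbert space `L²(ℝ^N)` of real-valued functions (modulo a.e. equality). -/
abbrev L2 (N : ℕ) : Type := Lp ℝ 2 (volume : Measure (Eucl N))

/-- The Hilbert space of complex-valued square-integrable functions on `ℝ^N`. -/
abbrev L2C (N : ℕ) : Type := Lp ℂ 2 (volume : Measure (Eucl N))

/-- A real-valued `L²` function regarded as a complex-valued one. -/
def cplx {N : ℕ} (u : L2 N) : L2C N := Complex.ofRealCLM.compLp u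

/-- `u ∈ H^s(ℝ^N)`: the integral of `|ξ|^{2s} |𝓕 u|²` is finite, with `𝓕` the Fourier transform on
`L²`. (Mathlib's `𝓕` has kernel `exp(-2πi x·ξ)`; the choice of normalisation only rescales `ξ`, so
it does not affect this condition.) -/
def MemHs {N : ℕ} (s : ℝ) (u : L2 N) : Prop :=
  ∫⁻ ξ : Eucl N, ENNReal.ofReal (‖ξ‖ ^ (2 * s)) * ‖(𝓕 (cplx u) : L2C N) ξ‖ₑ ^ 2 < ⊤

open Classical in
/-- The `L²` function that represents a tempered distribution `T`, when there is one
(and `0` otherwise). -/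
def asL2 {N : ℕ} (T : 𝓢'(Eucl N, ℂ)) : L2C N :=
  if h : ∃ g : L2C N, T = (g : 𝓢'(Eucl N, ℂ)) then h.choose else 0

/-- The `k`-th iterate `Δ^k u` of the Laplacian, in the sense of distributions. -/
def lapIter {N : ℕ} (k : ℕ) (u : L2 N) : 𝓢'(Eucl N, ℂ) :=
  (fun T : 𝓢'(Eucl N, ℂ) => Δ T)^[k] (cplx u : 𝓢'(Eucl N, ℂ))

open Classical in
/-- The fractional Laplacian `(-Δ)^σ v` of an `L²` function, that is, the inverse Fourier transform
of `|·|^{2σ} 𝓕 v`, when the latter is in `L²` (and `0` otherwise). As Mathlib's `𝓕` has kernel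
`exp(-2πi x·ξ)`, the symbol of `-Δ` is `(2π‖ξ‖)²`. -/
def fracLap {N : ℕ} (σ : ℝ) (v : L2C N) : L2C N :=
  if h : MemLp (fun ξ : Eucl N => (((2 * Real.pi * ‖ξ‖) ^ (2 * σ) : ℝ) : ℂ) * (𝓕 v : L2C N) ξ) 2
      (volume : Measure (Eucl N))
  then 𝓕⁻ (h.toLp) else 0

open Classical in
/-- The function `|D^s u|²`, where, with `k = ⌊s/2⌋`,
* `D^s u = Δ^{s/2} u` if `s` is an even integer (then `s = 2k`);
* `D^s u = ∇ Δ^{(s-1)/2} u` if `s` is an odd integer (then `s = 2k + 1`);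
* `D^s u = (-Δ)^{s/2 - k} (-Δ)^k u` if `s` is not an integer. -/
def DsSq {N : ℕ} (s : ℝ) (u : L2 N) (x : Eucl N) : ℝ :=
  if s = 2 * (⌊s / 2⌋₊ : ℝ) then
    ‖asL2 (lapIter ⌊s / 2⌋₊ u) x‖ ^ 2
  else if s = 2 * (⌊s / 2⌋₊ : ℝ) + 1 then
    ∑ i : Fin N, ‖asL2 (∂_{EuclideanSpace.single i (1 : ℝ)} (lapIter ⌊s / 2⌋₊ u)) x‖ ^ 2
  else
    ‖fracLap (s / 2 - (⌊s / 2⌋₊ : ℝ))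
      (asL2 ((-1 : ℂ) ^ ⌊s / 2⌋₊ • lapIter ⌊s / 2⌋₊ u)) x‖ ^ 2

/-- The primitive `F(t) = ∫₀ᵗ f(r) dr`. -/
def primitive (f : ℝ → ℝ) (t : ℝ) : ℝ := ∫ r in (0 : ℝ)..t, f r

/-- The energy `J(u) = ½ ∫ |D^s u|² dx - ∫ F(u) dx`. -/
def J (N : ℕ) (s : ℝ) (f : ℝ → ℝ) (u : L2 N) : ℝ :=
  (1 / 2) * (∫ x : Eucl N, DsSq s u x) - ∫ x : Eucl N, primitive f (u x)

/-- The set of `u ∈ H^s(ℝ^N)` with `∫ u² dx ≤ ρ`. -/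
def D0 (N : ℕ) (s ρ : ℝ) : Set (L2 N) :=
  {u | MemHs s u ∧ ∫ x : Eucl N, (u x) ^ 2 ≤ ρ}

/-- The infimum of `J` over `D0 N s ρ`, an extended real number (it may be `-∞`). -/
def m0 (N : ℕ) (s : ℝ) (f : ℝ → ℝ) (ρ : ℝ) : EReal :=
  sInf ((fun u : L2 N => (J N s f u : EReal)) '' D0 N s ρ)

/-- The infimum of the `ρ > 0` with `m0 ρ < 0`, an extended real number (`+∞` if there are none). -/
def rhoStar0 (N : ℕ) (s : ℝ) (f : ℝ → ℝ) : EReal :=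
  sInf ((fun ρ : ℝ => (ρ : EReal)) '' {ρ : ℝ | 0 < ρ ∧ m0 N s f ρ < 0})

/-- The mass-critical exponent `2 + 4s/N`. -/
def twoSharp (N : ℕ) (s : ℝ) : ℝ := 2 + 4 * s / N

/-- `α_N = N (2π)^N / ω_{N-1}`, with `ω_{N-1}` the surface measure of the unit sphere of `ℝ^N`. -/
def alphaN (N : ℕ) : ℝ :=
  N * (2 * Real.pi) ^ N / (volume : Measure (Eucl N)).toSphere.real Set.univ

/-- The continuity and growth assumptions on the nonlinearity `f`. In the last case,
`2^* - 1 = 2N / (N - 2s) - 1`. -/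
structure GrowthCondition (N : ℕ) (s : ℝ) (f : ℝ → ℝ) : Prop where
  continuous : Continuous f
  sub : (N : ℝ) < 2 * s → ∃ C : ℝ, 0 < C ∧ ∀ t ∈ Set.Icc (-1 : ℝ) 1, |f t| ≤ C * |t|
  crit : (N : ℝ) = 2 * s → ∀ q : ℝ, 2 ≤ q → ∀ α : ℝ, alphaN N < α →
    ∃ C : ℝ, 0 < C ∧ ∀ t : ℝ, |f t| ≤ C * (|t| + |t| ^ (q - 1) * (Real.exp (α * t ^ 2) - 1))
  super : 2 * s < (N : ℝ) → ∃ C : ℝ, 0 < C ∧ ∀ t : ℝ,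
    |f t| ≤ C * (|t| + |t| ^ (2 * (N : ℝ) / ((N : ℝ) - 2 * s) - 1))

end MassCritical

end

open MeasureTheory
open scoped SchwartzMap FourierTransform Laplacian LineDeriv

noncomputable section

namespace MassCritical

variable {N : ℕ}

/-! Write `r` for the critical mass, `K` for `kinetic` and `p` for the exponent `2 + 4s/N`. By
definition of `r` the energy is nonnegative at masses below `r`, and dilations extend this to mass
`r` (`J_nonneg_of_mem_D0`). As `J 0 = 0`, a minimiser `u` at mass `r` has `J u ≤ 0`. The rescaled
function `w = l^(N/2) u(l ·)` has the same mass, `K(w) = l^(2s) K(u)`, and potential energy `l^(-N)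
∫ F(l^(N/2) u)`. The exponent `p` is mass-critical because `(l^(N/2))^p = l^(N+2s)`. The strict
inequality between `p F(t)` and `f(t) t` makes `a ↦ F(a t) a^(-p)` strictly monotone, so `F(m t) >
m^p F(t)` for `m > 1` in one case and for `0 < m < 1` in the other. With `l = 2`, respectively `l =
1/2`, a nonzero `u` would give `J w < l^(2s) J u ≤ 0`, a contradiction (`eq_zero_of_isMinOn`).

The delicate point is the integrability of `F(w)`, since the Bochner integral is `0` otherwise. The
mass-critical Gagliardo–Nirenberg inequality bounds `∫ |w|^p`, and monotonicity bounds `F`, on one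
side, by `t² + |t|^p`. The other side is obtained from `J ≥ 0` on frequency truncations of `w` and
Fatou's lemma if `p F(t) < f(t) t`, and by comparison with `F(u)` in the opposite case. Neither a
Sobolev embedding at the exponent `2^*` nor an exponential inequality is needed. -/

/-! ### The Fourier transform on `L²`: duality, conjugation, dilation, sup bound. -/

theorem toTemperedDistribution_injective {g h : L2C N}
    (H : (g : 𝓢'(Eucl N, ℂ)) = (h : 𝓢'(Eucl N, ℂ))) : g = h := by
  have := Lp.ker_toTemperedDistributionCLM_eq_bot (F := ℂ) (E := Eucl N)
    (μ := volume) (p := 2)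
  exact (LinearMap.ker_eq_bot.1 this) H

theorem asL2_coe (g : L2C N) : asL2 (g : 𝓢'(Eucl N, ℂ)) = g := by
  have h : ∃ g' : L2C N, (g : 𝓢'(Eucl N, ℂ)) = (g' : 𝓢'(Eucl N, ℂ)) := ⟨g, rfl⟩
  rw [asL2, dif_pos h]
  exact (toTemperedDistribution_injective h.choose_spec).symm

theorem integral_schwartz_mul_fourier (g : L2C N) (φ : 𝓢(Eucl N, ℂ)) :
    ∫ x, φ x * (𝓕 g : L2C N) x = ∫ x, (𝓕 φ : 𝓢(Eucl N, ℂ)) x * g x := by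
  have := congrArg (fun T : 𝓢'(Eucl N, ℂ) => T φ) (Lp.fourier_toTemperedDistribution_eq g)
  simp only [TemperedDistribution.fourier_apply, Lp.toTemperedDistribution_apply,
    smul_eq_mul] at this
  exact this.symm

/-- Pairing with Schwartz functions separates `L²`. This reduces the conjugation and dilation rules
to Schwartz functions, where the transform is an honest integral. -/
theorem fourier_eq_of_forall_schwartz {g h : L2C N}
    (H : ∀ φ : 𝓢(Eucl N, ℂ), ∫ x, φ x * h x = ∫ x, (𝓕 φ : 𝓢(Eucl N, ℂ)) x * g x) : 𝓕 g = h := by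
  apply toTemperedDistribution_injective
  ext φ
  simp only [Lp.toTemperedDistribution_apply, smul_eq_mul]
  rw [H, integral_schwartz_mul_fourier]

/-- The Schwartz function `x ↦ conj (φ (-x))`. -/
def conjNeg (φ : 𝓢(Eucl N, ℂ)) : 𝓢(Eucl N, ℂ) :=
  SchwartzMap.postcompCLM (𝕜 := ℝ) (Complex.conjCLE : ℂ →L[ℝ] ℂ)
    (SchwartzMap.compCLMOfContinuousLinearEquiv ℝ (ContinuousLinearEquiv.neg ℝ) φ)

theorem conjNeg_apply (φ : 𝓢(Eucl N, ℂ)) (x : Eucl N) :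
    conjNeg φ x = starRingEnd ℂ (φ (-x)) := by
  simp [conjNeg]

theorem fourier_conjNeg (φ : 𝓢(Eucl N, ℂ)) (x : Eucl N) :
    (𝓕 (conjNeg φ) : 𝓢(Eucl N, ℂ)) x = starRingEnd ℂ ((𝓕 φ : 𝓢(Eucl N, ℂ)) x) := by
  rw [SchwartzMap.fourier_coe, SchwartzMap.fourier_coe, Real.fourier_eq', Real.fourier_eq',
    ← integral_conj, ← integral_neg_eq_self]
  congr 1
  ext v
  have h2 : (starRingEnd ℂ) 2 = 2 := Complex.conj_ofNat 2
  simp [conjNeg_apply, ← Complex.exp_conj, h2]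

theorem fourier_ae_eq_conj {g h : L2C N} (hg : ∀ᵐ x, h x = starRingEnd ℂ (g x)) :
    ∀ᵐ ξ, (𝓕 h : L2C N) ξ = starRingEnd ℂ ((𝓕 g : L2C N) (-ξ)) := by
  have hm : MemLp (fun ξ => starRingEnd ℂ ((𝓕 g : L2C N) (-ξ))) 2 (volume : Measure (Eucl N)) := by
    have h1 := (Lp.memLp (𝓕 g : L2C N)).comp_measurePreserving
      (Measure.measurePreserving_neg (volume : Measure (Eucl N)))
    have := h1.star
    exact this
  have key : 𝓕 h = hm.toLp _ := by
    apply fourier_eq_of_forall_schwartz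
    intro φ
    calc ∫ x, φ x * (hm.toLp _ : L2C N) x = ∫ x, φ x * starRingEnd ℂ ((𝓕 g : L2C N) (-x)) := by
          apply integral_congr_ae
          filter_upwards [hm.coeFn_toLp] with x hx
          rw [hx]
      _ = ∫ x, φ (-x) * starRingEnd ℂ ((𝓕 g : L2C N) x) := by
          rw [← integral_neg_eq_self]; simp
      _ = starRingEnd ℂ (∫ x, conjNeg φ x * (𝓕 g : L2C N) x) := by
          rw [← integral_conj]; simp [conjNeg_apply]
      _ = starRingEnd ℂ (∫ x, (𝓕 (conjNeg φ) : 𝓢(Eucl N, ℂ)) x * g x) := by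
          rw [integral_schwartz_mul_fourier]
      _ = ∫ x, (𝓕 φ : 𝓢(Eucl N, ℂ)) x * h x := by
          rw [← integral_conj]
          apply integral_congr_ae
          filter_upwards [hg] with x hx
          simp [fourier_conjNeg, hx]
  rw [key]
  exact hm.coeFn_toLp

/-- The Schwartz function `x ↦ φ (l x)`. -/
def dilSchwartz (l : ℝ) (hl : l ≠ 0) (φ : 𝓢(Eucl N, ℂ)) : 𝓢(Eucl N, ℂ) :=
  SchwartzMap.compCLMOfContinuousLinearEquiv ℝ
    (ContinuousLinearEquiv.smulLeft (Units.mk0 l hl)) φ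

theorem dilSchwartz_apply (l : ℝ) (hl : l ≠ 0) (φ : 𝓢(Eucl N, ℂ)) (x : Eucl N) :
    dilSchwartz l hl φ x = φ (l • x) := by
  rfl

theorem fourier_dilSchwartz (l : ℝ) (hl : 0 < l) (φ : 𝓢(Eucl N, ℂ)) (x : Eucl N) :
    (𝓕 (dilSchwartz l hl.ne' φ) : 𝓢(Eucl N, ℂ)) x = ((l ^ N)⁻¹ : ℝ) • (𝓕 φ : 𝓢(Eucl N, ℂ)) (l⁻¹ • x) := by
  rw [SchwartzMap.fourier_coe, SchwartzMap.fourier_coe, Real.fourier_eq', Real.fourier_eq']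
  have := Measure.integral_comp_smul (volume : Measure (Eucl N))
    (fun v : Eucl N => Complex.exp (↑(-2 * Real.pi * inner ℝ v (l⁻¹ • x)) * Complex.I) • φ v) l
  rw [finrank_euclideanSpace_fin, abs_of_pos (by positivity)] at this
  rw [← this]
  congr 1
  ext v
  rw [dilSchwartz_apply, inner_smul_left, inner_smul_right]
  simp [hl.ne']

theorem memLp_comp_smul {E : Type*} [NormedAddCommGroup E] {g : Eucl N → E} {p : ENNReal}
    (hg : MemLp g p volume) {l : ℝ} (hl : l ≠ 0) : MemLp (fun x => g (l • x)) p volume := by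
  have h1 : Measure.map (fun x : Eucl N => l • x) volume
      = ENNReal.ofReal |(l ^ Module.finrank ℝ (Eucl N))⁻¹| • volume :=
    Measure.map_addHaar_smul _ hl
  have h2 : MemLp g p (Measure.map (fun x : Eucl N => l • x) volume) := by
    rw [h1]; exact hg.smul_measure ENNReal.ofReal_ne_top
  exact h2.comp_of_map (by fun_prop)

theorem ae_comp_smul {p : Eucl N → Prop} (hp : ∀ᵐ x, p x) {l : ℝ} (hl : l ≠ 0) :
    ∀ᵐ x : Eucl N, p (l • x) := by
  have h1 : Measure.map (fun x : Eucl N => l • x) volume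
      = ENNReal.ofReal |(l ^ Module.finrank ℝ (Eucl N))⁻¹| • volume :=
    Measure.map_addHaar_smul _ hl
  have h2 : ∀ᵐ x ∂(Measure.map (fun x : Eucl N => l • x) volume), p x := by
    rw [h1]; exact Measure.ae_smul_measure hp _
  exact ae_of_ae_map (by fun_prop) h2

theorem fourier_ae_eq_dilation {g h : L2C N} {l c : ℝ} (hl : 0 < l)
    (hg : ∀ᵐ x, h x = c * g (l • x)) :
    ∀ᵐ ξ, (𝓕 h : L2C N) ξ = (c * (l ^ N)⁻¹ : ℝ) * (𝓕 g : L2C N) (l⁻¹ • ξ) := by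
  have hm : MemLp (fun ξ => ((c * (l ^ N)⁻¹ : ℝ) : ℂ) * (𝓕 g : L2C N) (l⁻¹ • ξ)) 2
      (volume : Measure (Eucl N)) :=
    (memLp_comp_smul (Lp.memLp (𝓕 g : L2C N)) (inv_ne_zero hl.ne')).const_mul _
  have key : 𝓕 h = hm.toLp _ := by
    apply fourier_eq_of_forall_schwartz
    intro φ
    calc ∫ x, φ x * (hm.toLp _ : L2C N) x
        = ∫ x, φ x * (((c * (l ^ N)⁻¹ : ℝ) : ℂ) * (𝓕 g : L2C N) (l⁻¹ • x)) := by
          apply integral_congr_ae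
          filter_upwards [hm.coeFn_toLp] with x hx
          rw [hx]
      _ = ∫ x, (fun y => φ (l • y) * (((c * (l ^ N)⁻¹ : ℝ) : ℂ) * (𝓕 g : L2C N) y)) (l⁻¹ • x) := by
          simp [hl.ne']
      _ = c * ∫ y, dilSchwartz l hl.ne' φ y * (𝓕 g : L2C N) y := by
          have := Measure.integral_comp_smul (volume : Measure (Eucl N))
            (fun y => φ (l • y) * (((c * (l ^ N)⁻¹ : ℝ) : ℂ) * (𝓕 g : L2C N) y)) l⁻¹
          rw [finrank_euclideanSpace_fin, abs_of_pos (by positivity)] at this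
          rw [this, ← integral_smul, ← integral_const_mul]
          congr 1
          ext y
          rw [dilSchwartz_apply]
          push_cast
          rw [Complex.real_smul]
          push_cast
          have : (l : ℂ) ≠ 0 := by exact_mod_cast hl.ne'
          rw [inv_pow, inv_inv]
          field_simp
      _ = c * ∫ y, ((l ^ N)⁻¹ : ℝ) • ((𝓕 φ : 𝓢(Eucl N, ℂ)) (l⁻¹ • y) * g y) := by
          rw [integral_schwartz_mul_fourier]
          simp_rw [fourier_dilSchwartz l hl, smul_mul_assoc]
      _ = c * ∫ y, (𝓕 φ : 𝓢(Eucl N, ℂ)) y * g (l • y) := by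
          have := Measure.integral_comp_smul (volume : Measure (Eucl N))
            (fun y => (𝓕 φ : 𝓢(Eucl N, ℂ)) (l⁻¹ • y) * g y) l
          rw [finrank_euclideanSpace_fin, abs_of_pos (by positivity)] at this
          rw [integral_smul, ← this]
          simp [hl.ne']
      _ = ∫ x, (𝓕 φ : 𝓢(Eucl N, ℂ)) x * h x := by
          rw [← integral_const_mul]
          apply integral_congr_ae
          filter_upwards [hg] with x hx
          rw [hx]; ring
  rw [key]
  exact hm.coeFn_toLp

/-- The `L²` inverse transform agrees a.e. with the continuous function given by the inverse Fourier
integral: both have the same pairings with smooth compactly supported functions. -/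
theorem norm_fourierInv_le_of_integrable {h : L2C N} (hi : Integrable h) :
    ∀ᵐ x, ‖(𝓕⁻ h : L2C N) x‖ ≤ ∫ ξ, ‖h ξ‖ := by
  set G : Eucl N → ℂ := 𝓕⁻ (h : Eucl N → ℂ) with hG
  have hGc : Continuous G :=
    VectorFourier.fourierIntegral_continuous Real.continuous_fourierChar
      (by exact continuous_inner.neg) hi
  have hGb : ∀ x, ‖G x‖ ≤ ∫ ξ, ‖h ξ‖ := fun x =>
    VectorFourier.norm_fourierIntegral_le_integral_norm _ _ _ _ _
  have key : ∀ φ : 𝓢(Eucl N, ℂ), ∫ x, φ x * (𝓕⁻ h : L2C N) x = ∫ x, φ x * G x := by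
    intro φ
    have h1 : ∫ x, φ x * (𝓕⁻ h : L2C N) x = ∫ x, (𝓕⁻ φ : 𝓢(Eucl N, ℂ)) x * h x := by
      have := integral_schwartz_mul_fourier (𝓕⁻ h : L2C N) (𝓕⁻ φ)
      rw [FourierTransform.fourier_fourierInv_eq, FourierTransform.fourier_fourierInv_eq] at this
      exact this.symm
    rw [h1, SchwartzMap.fourierInv_coe]
    have h2 := VectorFourier.integral_fourierIntegral_smul_eq_flip
      (L := -innerₗ (Eucl N)) Real.continuous_fourierChar
      (by exact continuous_inner.neg) (φ.integrable (μ := volume)) hi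
    have h3 : (-innerₗ (Eucl N)).flip = -innerₗ (Eucl N) := by
      ext x y; simp [real_inner_comm]
    rw [h3] at h2
    exact h2
  have : ∀ᵐ x, (𝓕⁻ h : L2C N) x - G x = 0 := by
    apply ae_eq_zero_of_integral_contDiff_smul_eq_zero
    · exact ((Lp.memLp (𝓕⁻ h : L2C N)).locallyIntegrable (by norm_num)).sub
        hGc.locallyIntegrable
    · intro g g_smooth g_cpt
      have hg₁ : HasCompactSupport (Complex.ofRealCLM ∘ g) := g_cpt.comp_left rfl
      have hg₂ : ContDiff ℝ ((⊤ : ℕ∞) : WithTop ℕ∞) (Complex.ofRealCLM ∘ g) := by fun_prop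
      have h1 := key (hg₁.toSchwartzMap hg₂)
      have e : ∀ (x : Eucl N) (z : ℂ), hg₁.toSchwartzMap hg₂ x * z = g x • z := fun x z => by
        simp
      simp_rw [e] at h1
      simp_rw [smul_sub]
      rw [integral_sub, h1, sub_self]
      · exact ((Lp.memLp (𝓕⁻ h : L2C N)).locallyIntegrable
          (by norm_num)).integrable_smul_left_of_hasCompactSupport g_smooth.continuous g_cpt
      · exact hGc.locallyIntegrable.integrable_smul_left_of_hasCompactSupport
          g_smooth.continuous g_cpt
  filter_upwards [this] with x hx
  rw [sub_eq_zero.1 hx]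
  exact hGb x

theorem lintegral_fourier_sq (g : L2C N) :
    ∫⁻ ξ, ‖(𝓕 g : L2C N) ξ‖ₑ ^ 2 = ∫⁻ x, ‖g x‖ₑ ^ 2 := by
  have h := Lp.norm_fourier_eq g
  have key : ∀ f : L2C N, ∫⁻ x, ‖f x‖ₑ ^ 2 = ENNReal.ofReal (‖f‖ ^ 2) := by
    intro f
    rw [ENNReal.ofReal_pow (norm_nonneg _), Lp.norm_def, ENNReal.ofReal_toReal (Lp.eLpNorm_ne_top f),
      eLpNorm_eq_lintegral_rpow_enorm_toReal (by norm_num) (by norm_num)]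
    rw [← ENNReal.rpow_natCast, ← ENNReal.rpow_mul]
    simp
  rw [key, key, h]

/-! ### The kinetic energy on the Fourier side. -/

/-- `∫ (2π|ξ|)^{2s} |𝓕 u|² dξ`, the square of the homogeneous Sobolev seminorm of `u`. -/
def kinetic (s : ℝ) (u : L2 N) : ENNReal :=
  ∫⁻ ξ : Eucl N, ENNReal.ofReal ((2 * Real.pi * ‖ξ‖) ^ (2 * s)) * ‖(𝓕 (cplx u) : L2C N) ξ‖ₑ ^ 2

theorem memHs_iff {s : ℝ} {u : L2 N} : MemHs s u ↔ kinetic s u < ⊤ := by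
  have h : kinetic s u = ENNReal.ofReal ((2 * Real.pi) ^ (2 * s)) *
      ∫⁻ ξ : Eucl N, ENNReal.ofReal (‖ξ‖ ^ (2 * s)) * ‖(𝓕 (cplx u) : L2C N) ξ‖ₑ ^ 2 := by
    rw [kinetic, ← lintegral_const_mul' _ _ ENNReal.ofReal_ne_top]
    congr 1
    ext ξ
    rw [Real.mul_rpow (by positivity) (norm_nonneg _), ENNReal.ofReal_mul (by positivity), mul_assoc]
  have h0 : ENNReal.ofReal ((2 * Real.pi) ^ (2 * s)) ≠ 0 := by
    rw [Ne, ENNReal.ofReal_eq_zero, not_le]; positivity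
  rw [h, MemHs]
  constructor
  · exact fun H => ENNReal.mul_lt_top ENNReal.ofReal_lt_top H
  · intro H
    by_contra hc
    rw [not_lt, top_le_iff] at hc
    rw [hc, ENNReal.mul_top h0] at H
    exact lt_irrefl _ H

theorem cplx_ae (u : L2 N) : ∀ᵐ x, cplx u x = (u x : ℂ) :=
  ContinuousLinearMap.coeFn_compLp Complex.ofRealCLM u

theorem asL2_of_fourier {T : 𝓢'(Eucl N, ℂ)} {G : L2C N} (h : 𝓕 T = (G : 𝓢'(Eucl N, ℂ))) :
    asL2 T = (𝓕⁻ G : L2C N) := by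
  have : T = ((𝓕⁻ G : L2C N) : 𝓢'(Eucl N, ℂ)) := by
    rw [← Lp.fourierInv_toTemperedDistribution_eq, ← h, FourierTransform.fourierInv_fourier_eq]
  rw [this, asL2_coe]

theorem smulLeftCLM_coe {b : Eucl N → ℂ} (hb : b.HasTemperateGrowth) {v G : L2C N}
    (h : ∀ᵐ ξ, G ξ = b ξ * v ξ) :
    TemperedDistribution.smulLeftCLM ℂ b (v : 𝓢'(Eucl N, ℂ)) = (G : 𝓢'(Eucl N, ℂ)) := by
  ext φ
  simp only [TemperedDistribution.smulLeftCLM_apply_apply, Lp.toTemperedDistribution_apply,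
    smul_eq_mul]
  apply integral_congr_ae
  filter_upwards [h] with x hx
  rw [hx, SchwartzMap.smulLeftCLM_apply_apply hb, smul_eq_mul]
  ring

/-- The symbol of the Laplacian. -/
def lapSymbol (ξ : Eucl N) : ℂ := ((-(2 * Real.pi * ‖ξ‖) ^ 2 : ℝ) : ℂ)

theorem lapSymbol_hasTemperateGrowth : (lapSymbol (N := N)).HasTemperateGrowth := by
  have : (lapSymbol (N := N)) = fun ξ => -((2 * Real.pi : ℂ) ^ 2) * Complex.ofReal (‖ξ‖ ^ 2) := by
    ext ξ; simp [lapSymbol]; ring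
  rw [this]
  fun_prop

theorem lapSymbol_pow_hasTemperateGrowth (k : ℕ) :
    (fun ξ => lapSymbol (N := N) ξ ^ k).HasTemperateGrowth := by
  have := lapSymbol_hasTemperateGrowth (N := N)
  fun_prop

theorem fourier_laplacian (T : 𝓢'(Eucl N, ℂ)) :
    𝓕 (Δ T) = TemperedDistribution.smulLeftCLM ℂ lapSymbol (𝓕 T) := by
  have e : (lapSymbol (N := N)) =
      (-((2 * Real.pi : ℂ) ^ 2)) • fun ξ => Complex.ofReal (‖ξ‖ ^ 2) := by
    ext ξ; simp [lapSymbol]; ring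
  have ht : (fun ξ : Eucl N => Complex.ofReal (‖ξ‖ ^ 2)).HasTemperateGrowth := by fun_prop
  rw [e, TemperedDistribution.smulLeftCLM_smul ht,
    TemperedDistribution.laplacian_eq_fourierMultiplierCLM,
    TemperedDistribution.fourierMultiplierCLM_apply]
  rw [← Complex.coe_smul, FourierTransform.fourier_smul, FourierTransform.fourier_fourierInv_eq]
  simp
  exact neg_smul ((2 * Real.pi : ℂ) ^ 2)
    (TemperedDistribution.smulLeftCLM ℂ (fun ξ : Eucl N => (‖ξ‖ : ℂ) ^ 2) (𝓕 T))

theorem fourier_lapIter (k : ℕ) (u : L2 N) :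
    𝓕 (lapIter k u) = TemperedDistribution.smulLeftCLM ℂ (fun ξ => lapSymbol ξ ^ k)
      ((𝓕 (cplx u) : L2C N) : 𝓢'(Eucl N, ℂ)) := by
  induction k with
  | zero =>
    simp [lapIter, Lp.fourier_toTemperedDistribution_eq]
  | succ k ih =>
    rw [lapIter, Function.iterate_succ_apply', ← lapIter, fourier_laplacian, ih,
      TemperedDistribution.smulLeftCLM_smulLeftCLM_apply (lapSymbol_pow_hasTemperateGrowth k)
        lapSymbol_hasTemperateGrowth]
    congr 2

theorem lintegral_enorm_sq_lt_top (G : L2C N) : ∫⁻ ξ, ‖G ξ‖ₑ ^ 2 < ⊤ := by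
  have := (Lp.memLp G).2
  rw [eLpNorm_lt_top_iff_lintegral_rpow_enorm_lt_top (by norm_num) (by norm_num)] at this
  simpa using this

theorem memLp_mul_fourier {s a : ℝ} (ha : 0 ≤ a) (has : a ≤ s) {u : L2 N}
    (hu : kinetic s u < ⊤) {b : Eucl N → ℂ} (hbm : Continuous b)
    (hb : ∀ ξ, ‖b ξ‖ ≤ (2 * Real.pi * ‖ξ‖) ^ a) :
    MemLp (fun ξ => b ξ * (𝓕 (cplx u) : L2C N) ξ) 2 (volume : Measure (Eucl N)) := by
  refine ⟨hbm.aestronglyMeasurable.mul (Lp.aestronglyMeasurable _), ?_⟩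
  rw [eLpNorm_lt_top_iff_lintegral_rpow_enorm_lt_top (by norm_num) (by norm_num)]
  have hL := lintegral_enorm_sq_lt_top (𝓕 (cplx u) : L2C N)
  calc ∫⁻ ξ, ‖b ξ * (𝓕 (cplx u) : L2C N) ξ‖ₑ ^ (ENNReal.toReal 2)
      ≤ ∫⁻ ξ, (‖(𝓕 (cplx u) : L2C N) ξ‖ₑ ^ 2 +
          ENNReal.ofReal ((2 * Real.pi * ‖ξ‖) ^ (2 * s)) * ‖(𝓕 (cplx u) : L2C N) ξ‖ₑ ^ 2) := by
        apply lintegral_mono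
        intro ξ
        -- Since `0 ≤ a ≤ s`, the power `2a` is dominated by the power `0` where `2π‖ξ‖ ≤ 1` and by
        -- the power `2s` elsewhere.
        have h1 : ‖b ξ‖ₑ ^ 2 ≤ 1 + ENNReal.ofReal ((2 * Real.pi * ‖ξ‖) ^ (2 * s)) := by
          rw [← ENNReal.ofReal_one, ← ENNReal.ofReal_add (by norm_num) (by positivity),
            ← ofReal_norm, ← ENNReal.ofReal_pow (norm_nonneg _)]
          apply ENNReal.ofReal_le_ofReal
          set r := 2 * Real.pi * ‖ξ‖ with hr
          have hr0 : 0 ≤ r := by positivity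
          have h2 : ‖b ξ‖ ^ 2 ≤ r ^ (2 * a) := by
            rw [mul_comm 2 a, Real.rpow_mul hr0, Real.rpow_two]
            exact pow_le_pow_left₀ (norm_nonneg _) (hb ξ) 2
          rcases le_total r 1 with h | h
          · have := Real.rpow_le_one hr0 h (by positivity : 0 ≤ 2 * a)
            have := Real.rpow_nonneg hr0 (2 * s)
            linarith
          · have := Real.rpow_le_rpow_of_exponent_le h (by linarith : 2 * a ≤ 2 * s)
            linarith
        simp only [enorm_mul, ENNReal.toReal_ofNat, ENNReal.rpow_ofNat]
        rw [mul_pow]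
        calc _ ≤ (1 + ENNReal.ofReal ((2 * Real.pi * ‖ξ‖) ^ (2 * s))) *
              ‖(𝓕 (cplx u) : L2C N) ξ‖ₑ ^ 2 := by gcongr
          _ = _ := by ring
    _ < ⊤ := by
        rw [lintegral_add_left']
        · exact ENNReal.add_lt_top.2 ⟨hL, hu⟩
        · exact (Lp.aestronglyMeasurable _).enorm.pow_const 2

theorem integral_norm_sq_fourierInv (G : L2C N) :
    ∫ x, ‖(𝓕⁻ G : L2C N) x‖ ^ 2 = (∫⁻ ξ, ‖G ξ‖ₑ ^ 2).toReal := by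
  have h := lintegral_fourier_sq (𝓕⁻ G : L2C N)
  rw [FourierTransform.fourier_fourierInv_eq] at h
  rw [h, integral_eq_lintegral_of_nonneg_ae (by filter_upwards with x; positivity)
    (by exact (Lp.aestronglyMeasurable _).norm.pow 2)]
  congr 2
  ext x
  rw [ENNReal.ofReal_pow (norm_nonneg _), ofReal_norm]

theorem integrable_norm_sq (G : L2C N) : Integrable (fun x => ‖G x‖ ^ 2) :=
  (memLp_two_iff_integrable_sq_norm (Lp.aestronglyMeasurable _)).1 (Lp.memLp G)

theorem norm_lapSymbol_pow (k : ℕ) (ξ : Eucl N) :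
    ‖lapSymbol ξ ^ k‖ = (2 * Real.pi * ‖ξ‖) ^ (2 * (k : ℝ)) := by
  have : 0 ≤ 2 * Real.pi * ‖ξ‖ := by positivity
  rw [norm_pow, lapSymbol, Complex.norm_real, norm_neg, Real.norm_of_nonneg (by positivity),
    ← pow_mul, ← Real.rpow_natCast]
  push_cast; rfl

theorem enorm_sq_eq_of_norm_eq {z : ℂ} {r a : ℝ} (hr : 0 ≤ r) (hz : ‖z‖ = r ^ a) :
    ‖z‖ₑ ^ 2 = ENNReal.ofReal (r ^ (2 * a)) := by
  rw [← ofReal_norm, hz, ← ENNReal.ofReal_pow (by positivity), mul_comm 2 a,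
    Real.rpow_mul hr, Real.rpow_two]

/-- Plancherel: in each case the symbol of `D^s` has modulus `(2π‖ξ‖)^s`; for odd `s` this uses `∑
ξᵢ² = ‖ξ‖²`. Most of the work is to check that every distribution involved is an `L²` function, so
that `asL2` and `fracLap` do not take their default value `0`. -/
theorem integral_DsSq {s : ℝ} (hs : 0 < s) {u : L2 N} (hu : MemHs s u) :
    ∫ x, DsSq s u x = (kinetic s u).toReal := by
  rw [memHs_iff] at hu
  set k := ⌊s / 2⌋₊ with hk
  have hks : 2 * (k : ℝ) ≤ s := by
    have := Nat.floor_le (by positivity : 0 ≤ s / 2)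
    linarith
  have hsym : Continuous fun ξ : Eucl N => lapSymbol ξ ^ k :=
    (lapSymbol_pow_hasTemperateGrowth k).1.continuous
  have hm0 : ∀ ξ : Eucl N, 0 ≤ 2 * Real.pi * ‖ξ‖ := fun ξ => by positivity
  have hG := memLp_mul_fourier (by positivity) hks hu hsym (fun ξ => (norm_lapSymbol_pow k ξ).le)
  have hlap : 𝓕 (lapIter k u) = ((hG.toLp _ : L2C N) : 𝓢'(Eucl N, ℂ)) := by
    rw [fourier_lapIter]
    exact smulLeftCLM_coe (lapSymbol_pow_hasTemperateGrowth k) hG.coeFn_toLp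
  unfold DsSq
  rw [← hk]
  split_ifs with h1 h2
  · rw [asL2_of_fourier hlap, integral_norm_sq_fourierInv, kinetic]
    congr 1
    apply lintegral_congr_ae
    filter_upwards [hG.coeFn_toLp] with ξ hξ
    rw [hξ, enorm_mul, mul_pow, enorm_sq_eq_of_norm_eq (hm0 ξ) (norm_lapSymbol_pow k ξ), h1]
  · have hb (i : Fin N) : ∀ ξ : Eucl N, ‖(2 * Real.pi * Complex.I) * (ξ i : ℂ) * lapSymbol ξ ^ k‖
        = (2 * Real.pi * |ξ i|) * (2 * Real.pi * ‖ξ‖) ^ (2 * (k : ℝ)) := by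
      intro ξ
      rw [norm_mul, norm_lapSymbol_pow]
      simp [abs_of_pos Real.pi_pos]
    have hGi (i : Fin N) : MemLp (fun ξ => ((2 * Real.pi * Complex.I) * (ξ i : ℂ) * lapSymbol ξ ^ k)
        * (𝓕 (cplx u) : L2C N) ξ) 2 (volume : Measure (Eucl N)) := by
      refine memLp_mul_fourier (a := s) hs.le le_rfl hu (by fun_prop) fun ξ => ?_
      rw [hb, h2, Real.rpow_add_one' (hm0 ξ) (by positivity), mul_comm]
      have : |ξ i| ≤ ‖ξ‖ := by simpa using PiLp.norm_apply_le ξ i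
      gcongr
    have hT (i : Fin N) : 𝓕 (∂_{EuclideanSpace.single i (1 : ℝ)} (lapIter k u)) =
        (((hGi i).toLp _ : L2C N) : 𝓢'(Eucl N, ℂ)) := by
      have ht : (fun ξ : Eucl N =>
          ((inner ℝ ξ (EuclideanSpace.single i (1 : ℝ)) : ℝ) : ℂ)).HasTemperateGrowth := by
        fun_prop
      rw [TemperedDistribution.fourier_lineDerivOp_eq, hlap, ← smul_apply,
        ← TemperedDistribution.smulLeftCLM_smul ht]
      refine smulLeftCLM_coe (by fun_prop) ?_
      filter_upwards [hG.coeFn_toLp, (hGi i).coeFn_toLp] with ξ h3 h4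
      rw [h3, h4]
      simp [EuclideanSpace.inner_single_right]
      ring
    simp_rw [fun i => asL2_of_fourier (hT i)]
    rw [integral_finsetSum _ fun i _ => integrable_norm_sq _]
    simp_rw [integral_norm_sq_fourierInv]
    rw [← ENNReal.toReal_sum fun i _ => (lintegral_enorm_sq_lt_top _).ne,
      ← lintegral_finsetSum' _ fun i _ => (Lp.aestronglyMeasurable _).enorm.pow_const 2, kinetic]
    congr 1
    apply lintegral_congr_ae
    filter_upwards [ae_all_iff.2 fun i => (hGi i).coeFn_toLp] with ξ hξ
    simp_rw [hξ, enorm_mul _ ((𝓕 (cplx u) : L2C N) ξ), mul_pow]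
    rw [← Finset.sum_mul]
    congr 1
    simp_rw [← ofReal_norm, ← ENNReal.ofReal_pow (norm_nonneg _), hb]
    rw [← ENNReal.ofReal_sum_of_nonneg fun i _ => by positivity]
    congr 1
    simp_rw [mul_pow, sq_abs]
    rw [← Finset.sum_mul, ← Finset.mul_sum, ← EuclideanSpace.real_norm_sq_eq ξ, h2,
      ← Real.rpow_natCast (_ ^ _) 2, ← Real.rpow_mul (hm0 ξ)]
    rw [show 2 * (2 * (k : ℝ) + 1) = 2 * (k : ℝ) * ((2 : ℕ) : ℝ) + ((2 : ℕ) : ℝ) by push_cast; ring,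
      Real.rpow_add_of_nonneg (hm0 ξ) (by positivity) (by positivity), Real.rpow_natCast _ 2]
    ring
  · have hlt : 2 * (k : ℝ) < s := lt_of_le_of_ne hks (Ne.symm h1)
    have hv : asL2 ((-1 : ℂ) ^ k • lapIter k u) = (𝓕⁻ ((-1 : ℂ) ^ k • hG.toLp _ : L2C N) : L2C N) := by
      apply asL2_of_fourier
      rw [FourierTransform.fourier_smul, hlap]
      exact ((Lp.toTemperedDistributionCLM ℂ volume 2).map_smul _ _).symm
    set v := asL2 ((-1 : ℂ) ^ k • lapIter k u) with hvd
    have hFv : (𝓕 v : L2C N) = (-1 : ℂ) ^ k • hG.toLp _ := by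
      rw [hv, FourierTransform.fourier_fourierInv_eq]
    have hnorm : ∀ᵐ ξ, ‖(((2 * Real.pi * ‖ξ‖) ^ (2 * (s / 2 - k)) : ℝ) : ℂ) * (𝓕 v : L2C N) ξ‖ₑ ^ 2
        = ENNReal.ofReal ((2 * Real.pi * ‖ξ‖) ^ (2 * s)) * ‖(𝓕 (cplx u) : L2C N) ξ‖ₑ ^ 2 := by
      rw [hFv]
      filter_upwards [Lp.coeFn_smul ((-1 : ℂ) ^ k) (hG.toLp _), hG.coeFn_toLp] with ξ h3 h4
      rw [h3, Pi.smul_apply, h4, smul_eq_mul, enorm_mul, enorm_mul, enorm_mul, mul_pow, mul_pow,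
        mul_pow, enorm_sq_eq_of_norm_eq (hm0 ξ) (norm_lapSymbol_pow k ξ),
        enorm_sq_eq_of_norm_eq (a := 2 * (s / 2 - k)) (hm0 ξ)
          (by rw [Complex.norm_real, Real.norm_of_nonneg (Real.rpow_nonneg (hm0 ξ) _)])]
      have : ‖(-1 : ℂ) ^ k‖ₑ = 1 := by simp [enorm_pow]
      rw [this, one_pow, one_mul, ← mul_assoc, ← ENNReal.ofReal_mul (by positivity),
        ← Real.rpow_add_of_nonneg (hm0 ξ) (by linarith) (by positivity)]
      congr 3
      ring
    have hM : MemLp (fun ξ : Eucl N => (((2 * Real.pi * ‖ξ‖) ^ (2 * (s / 2 - k)) : ℝ) : ℂ) *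
        (𝓕 v : L2C N) ξ) 2 (volume : Measure (Eucl N)) := by
      refine ⟨Continuous.aestronglyMeasurable ?_ |>.mul (Lp.aestronglyMeasurable _), ?_⟩
      · exact Complex.continuous_ofReal.comp ((continuous_const.mul continuous_norm).rpow_const
          fun ξ => Or.inr (by linarith))
      · rw [eLpNorm_lt_top_iff_lintegral_rpow_enorm_lt_top (by norm_num) (by norm_num)]
        simp only [ENNReal.toReal_ofNat, ENNReal.rpow_ofNat]
        rw [lintegral_congr_ae hnorm]
        exact hu
    rw [fracLap, dif_pos hM, integral_norm_sq_fourierInv, kinetic]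
    congr 1
    apply lintegral_congr_ae
    filter_upwards [hM.coeFn_toLp, hnorm] with ξ h3 h4
    rw [h3, h4]

/-! ### Frequency splitting and the mass-critical Gagliardo–Nirenberg inequality. -/

theorem memLp_indicator_fourier (R : ℝ) (g : L2C N) :
    MemLp (Set.indicator (Metric.closedBall (0 : Eucl N) R) (𝓕 g : L2C N)) 2 volume :=
  (Lp.memLp _).indicator Metric.isClosed_closedBall.measurableSet

/-- The Fourier transform of `g`, cut off outside the ball of radius `R`. -/
def fourierCut (R : ℝ) (g : L2C N) : L2C N := (memLp_indicator_fourier R g).toLp _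

theorem fourierCut_ae (R : ℝ) (g : L2C N) :
    ∀ᵐ ξ, fourierCut R g ξ = Set.indicator (Metric.closedBall (0 : Eucl N) R) (𝓕 g : L2C N) ξ :=
  (memLp_indicator_fourier R g).coeFn_toLp

variable (N) in
/-- The square root of the volume of the unit ball. -/
def ballConst : ℝ := ((volume (Metric.closedBall (0 : Eucl N) 1)).toReal) ^ (1 / 2 : ℝ)

theorem ballConst_pos : 0 < ballConst N := by
  apply Real.rpow_pos_of_pos
  refine ENNReal.toReal_pos (Metric.measure_closedBall_pos _ _ one_pos).ne'
    measure_closedBall_lt_top.ne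

/-- Cauchy–Schwarz on the ball, whose volume to the power `1/2` is `ballConst N * R^(N/2)`. -/
theorem fourierCut_integrable {R : ℝ} (hR : 0 ≤ R) (g : L2C N) :
    Integrable (fourierCut R g) ∧
      ∫ ξ, ‖fourierCut R g ξ‖ ≤ ballConst N * R ^ ((N : ℝ) / 2) * ‖g‖ := by
  set B := Metric.closedBall (0 : Eucl N) R with hB
  have hBm : MeasurableSet B := Metric.isClosed_closedBall.measurableSet
  have : IsFiniteMeasure (volume.restrict B) := ⟨by simpa using measure_closedBall_lt_top⟩
  have hL2 : MemLp (𝓕 g : L2C N) 2 (volume.restrict B) := (Lp.memLp _).restrict B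
  have hL1 : MemLp (𝓕 g : L2C N) 1 (volume.restrict B) := hL2.mono_exponent (by norm_num)
  have hi : Integrable (fourierCut R g) :=
    ((integrable_indicator_iff hBm).2 (memLp_one_iff_integrable.1 hL1)).congr
      (by filter_upwards [fourierCut_ae R g] with ξ h using h.symm)
  refine ⟨hi, ?_⟩
  have h1 : ∫ ξ, ‖fourierCut R g ξ‖ = (eLpNorm (𝓕 g : L2C N) 1 (volume.restrict B)).toReal := by
    rw [integral_norm_eq_lintegral_enorm hi.1, ← eLpNorm_one_eq_lintegral_enorm,
      ← eLpNorm_indicator_eq_eLpNorm_restrict hBm]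
    congr 1
    exact eLpNorm_congr_ae (fourierCut_ae R g)
  have h2 := eLpNorm_le_eLpNorm_mul_rpow_measure_univ (p := 1) (q := 2) (by norm_num) hL2.1
  have h3 : eLpNorm (𝓕 g : L2C N) 2 (volume.restrict B) ≤ ENNReal.ofReal ‖g‖ := by
    rw [← Lp.norm_fourier_eq g, Lp.norm_def, ENNReal.ofReal_toReal (Lp.eLpNorm_ne_top _)]
    exact eLpNorm_mono_measure _ Measure.restrict_le_self
  have h4 : (volume.restrict B) Set.univ =
      ENNReal.ofReal (R ^ N) * volume (Metric.closedBall (0 : Eucl N) 1) := by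
    rw [Measure.restrict_apply_univ, hB, Measure.addHaar_closedBall' _ _ hR,
      finrank_euclideanSpace_fin]
  have h5 : ((volume.restrict B) Set.univ) ^ (1 / (1 : ENNReal).toReal - 1 / (2 : ENNReal).toReal)
      = ENNReal.ofReal (ballConst N * R ^ ((N : ℝ) / 2)) := by
    have e : 1 / (1 : ENNReal).toReal - 1 / (2 : ENNReal).toReal = 1 / 2 := by norm_num
    have e1 : ENNReal.ofReal (ballConst N) =
        volume (Metric.closedBall (0 : Eucl N) 1) ^ (1 / 2 : ℝ) := by
      rw [ballConst, ← ENNReal.ofReal_rpow_of_nonneg (by positivity) (by norm_num),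
        ENNReal.ofReal_toReal measure_closedBall_lt_top.ne]
    have e2 : ENNReal.ofReal (R ^ N) ^ (1 / 2 : ℝ) = ENNReal.ofReal (R ^ ((N : ℝ) / 2)) := by
      rw [ENNReal.ofReal_rpow_of_nonneg (by positivity) (by norm_num), ← Real.rpow_natCast,
        ← Real.rpow_mul hR]
      congr 2
      ring
    rw [h4, e, ENNReal.mul_rpow_of_nonneg _ _ (by norm_num), e2, ← e1,
      ← ENNReal.ofReal_mul (by positivity), mul_comm]
  rw [h1]
  rw [h5] at h2
  refine ENNReal.toReal_le_of_le_ofReal (by have := ballConst_pos (N := N); positivity) ?_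
  calc _ ≤ _ := h2
    _ ≤ ENNReal.ofReal ‖g‖ * ENNReal.ofReal (ballConst N * R ^ ((N : ℝ) / 2)) := by gcongr
    _ = _ := by rw [← ENNReal.ofReal_mul (norm_nonneg _), mul_comm]

theorem lowFreq_bound {R : ℝ} (hR : 0 ≤ R) (g : L2C N) :
    ∀ᵐ x, ‖(𝓕⁻ (fourierCut R g) : L2C N) x‖ ≤ ballConst N * R ^ ((N : ℝ) / 2) * ‖g‖ := by
  obtain ⟨h1, h2⟩ := fourierCut_integrable hR g
  filter_upwards [norm_fourierInv_le_of_integrable h1] with x hx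
  exact hx.trans h2

theorem highFreq_sq (R : ℝ) (g : L2C N) :
    ∫⁻ x, ‖g x - (𝓕⁻ (fourierCut R g) : L2C N) x‖ₑ ^ 2 =
      ∫⁻ ξ, Set.indicator {ξ : Eucl N | R < ‖ξ‖} (fun ξ => ‖(𝓕 g : L2C N) ξ‖ₑ ^ 2) ξ := by
  have h1 := lintegral_fourier_sq (g - 𝓕⁻ (fourierCut R g) : L2C N)
  have h2 : (𝓕 (g - 𝓕⁻ (fourierCut R g)) : L2C N) = 𝓕 g - fourierCut R g := by
    have h := (Lp.fourierTransformₗᵢ (Eucl N) ℂ).map_sub g (𝓕⁻ (fourierCut R g))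
    have h' : (𝓕 (𝓕⁻ (fourierCut R g) : L2C N) : L2C N) = fourierCut R g :=
      FourierTransform.fourier_fourierInv_eq _
    exact h.trans (congrArg ((𝓕 g : L2C N) - ·) h')
  rw [h2] at h1
  have h3 : ∫⁻ x, ‖g x - (𝓕⁻ (fourierCut R g) : L2C N) x‖ₑ ^ 2 =
      ∫⁻ x, ‖(g - 𝓕⁻ (fourierCut R g) : L2C N) x‖ₑ ^ 2 := by
    apply lintegral_congr_ae
    filter_upwards [Lp.coeFn_sub g (𝓕⁻ (fourierCut R g))] with x hx
    rw [hx, Pi.sub_apply]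
  rw [h3, ← h1]
  apply lintegral_congr_ae
  filter_upwards [Lp.coeFn_sub (𝓕 g) (fourierCut R g), fourierCut_ae R g] with ξ h4 h5
  rw [h4, Pi.sub_apply, h5]
  by_cases h : R < ‖ξ‖
  · rw [Set.indicator_of_notMem (by simpa using h), Set.indicator_of_mem (by exact h), sub_zero]
  · rw [Set.indicator_of_mem (by simpa using h), Set.indicator_of_notMem (by exact h), sub_self]
    simp

/-- Split `g` at a frequency `R` depending on `t` so that the low part is at most `t/2`. Where `‖g‖
> t` the high part is then at least `t/2`, and Chebyshev with Plancherel concludes. -/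
theorem measure_superlevel_le {M t : ℝ} (hN : 1 ≤ N) (hM : 0 < M) (ht : 0 < t) (g : L2C N)
    (hg : ‖g‖ ≤ M) :
    volume {x | t < ‖g x‖} ≤ ENNReal.ofReal (4 * t ^ (-2 : ℝ)) *
      ∫⁻ ξ, Set.indicator {ξ : Eucl N | t < 2 * ballConst N * M * ‖ξ‖ ^ ((N : ℝ) / 2)}
        (fun ξ => ‖(𝓕 g : L2C N) ξ‖ₑ ^ 2) ξ := by
  have hb := ballConst_pos (N := N)
  have hN' : (0 : ℝ) < N := by exact_mod_cast hN
  set c := 2 * ballConst N * M with hc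
  have hc0 : 0 < c := by positivity
  -- This solves `ballConst N * R^(N/2) * M = t/2`.
  set R := (t / c) ^ (2 / (N : ℝ)) with hR
  have hR0 : 0 ≤ R := by positivity
  have hRt : R ^ ((N : ℝ) / 2) = t / c := by
    rw [hR, ← Real.rpow_mul (by positivity)]
    rw [show 2 / (N : ℝ) * (N / 2) = 1 by field_simp, Real.rpow_one]
  have hset : {ξ : Eucl N | R < ‖ξ‖} = {ξ : Eucl N | t < c * ‖ξ‖ ^ ((N : ℝ) / 2)} := by
    ext ξ
    rw [Set.mem_ofPred_eq, Set.mem_ofPred_eq, ← div_lt_iff₀' hc0, ← hRt,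
      Real.rpow_lt_rpow_iff hR0 (norm_nonneg _) (by positivity)]
  rw [← hset, ← highFreq_sq R g]
  set d : Eucl N → ℂ := fun x => g x - (𝓕⁻ (fourierCut R g) : L2C N) x with hd
  have hdm : AEMeasurable (fun x => ‖d x‖ₑ ^ 2) volume :=
    ((Lp.aestronglyMeasurable _).sub (Lp.aestronglyMeasurable _)).enorm.pow_const 2
  have hmark := meas_ge_le_lintegral_div hdm (ε := ENNReal.ofReal ((t / 2) ^ 2))
    (by rw [Ne, ENNReal.ofReal_eq_zero, not_le]; positivity) ENNReal.ofReal_ne_top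
  have hsub : volume {x | t < ‖g x‖} ≤ volume {x | ENNReal.ofReal ((t / 2) ^ 2) ≤ ‖d x‖ₑ ^ 2} := by
    apply measure_mono_ae
    filter_upwards [lowFreq_bound hR0 g] with x hx h1
    have h2 : t < ‖g x‖ := h1
    have h3 : ‖(𝓕⁻ (fourierCut R g) : L2C N) x‖ ≤ t / 2 := by
      refine hx.trans ?_
      rw [hRt]
      calc ballConst N * (t / c) * ‖g‖ ≤ ballConst N * (t / c) * M := by gcongr
        _ = t / 2 := by rw [hc]; field_simp
    have h4 : t / 2 ≤ ‖d x‖ := by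
      have := norm_sub_norm_le (g x) ((𝓕⁻ (fourierCut R g) : L2C N) x)
      simp only [hd]
      linarith
    show ENNReal.ofReal ((t / 2) ^ 2) ≤ ‖d x‖ₑ ^ 2
    rw [← ofReal_norm, ← ENNReal.ofReal_pow (norm_nonneg _)]
    gcongr
  refine hsub.trans (hmark.trans (le_of_eq ?_))
  rw [div_eq_mul_inv, mul_comm, ← ENNReal.ofReal_inv_of_pos (by positivity)]
  congr 2
  rw [Real.rpow_neg ht.le, Real.rpow_two]
  field_simp
  norm_num

theorem lintegral_rpow_Ioo {q a : ℝ} (hq : 0 < q) (ha : 0 ≤ a) :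
    ∫⁻ t in Set.Ioi (0 : ℝ), Set.indicator (Set.Iio a) (fun t => ENNReal.ofReal (t ^ (q - 1))) t
      = ENNReal.ofReal (a ^ q / q) := by
  have hi : IntegrableOn (fun t : ℝ => t ^ (q - 1)) (Set.Ioc 0 a) :=
    (intervalIntegrable_iff_integrableOn_Ioc_of_le ha).1
      (intervalIntegral.intervalIntegrable_rpow' (by linarith))
  rw [lintegral_indicator measurableSet_Iio, Measure.restrict_restrict measurableSet_Iio,
    Set.inter_comm, Set.Ioi_inter_Iio, restrict_Ioo_eq_restrict_Ioc,
    ← ofReal_integral_eq_lintegral_ofReal hi, ← intervalIntegral.integral_of_le ha,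
    integral_rpow (Or.inl (by linarith))]
  · simp [hq.ne']
  · filter_upwards [ae_restrict_mem measurableSet_Ioc] with t ht
    exact Real.rpow_nonneg ht.1.le _

/-- Layer-cake formula, the superlevel estimate, then Tonelli: for fixed `ξ` what remains is the
integral of `t^(q-1)` over `0 < t < c ‖ξ‖^(N/2)`, with `q = 4s/N`. -/
theorem gagliardo_nirenberg {s M : ℝ} (hN : 1 ≤ N) (hs : 0 < s) (hM : 0 < M) (g : L2C N)
    (hg : ‖g‖ ≤ M) :
    ∫⁻ x, ENNReal.ofReal (‖g x‖ ^ twoSharp N s) ≤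
      ENNReal.ofReal (twoSharp N s * 4 * ((2 * ballConst N * M) ^ (4 * s / N) / (4 * s / N))) *
        ∫⁻ ξ : Eucl N, ENNReal.ofReal (‖ξ‖ ^ (2 * s)) * ‖(𝓕 g : L2C N) ξ‖ₑ ^ 2 := by
  have hb := ballConst_pos (N := N)
  have hN' : (0 : ℝ) < N := by exact_mod_cast hN
  set c := 2 * ballConst N * M with hc
  have hc0 : 0 < c := by positivity
  set q := 4 * s / N with hq
  have hq0 : 0 < q := by positivity
  have hp : twoSharp N s = 2 + q := rfl
  rw [lintegral_rpow_eq_lintegral_meas_lt_mul volume (by filter_upwards with x; positivity)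
    (Lp.aestronglyMeasurable g).norm.aemeasurable (by rw [hp]; positivity)]
  have hgm : Measurable fun ξ => ‖(𝓕 g : L2C N) ξ‖ₑ ^ 2 :=
    (Lp.stronglyMeasurable (𝓕 g : L2C N)).measurable.enorm.pow_const 2
  calc ENNReal.ofReal (twoSharp N s) *
        ∫⁻ t in Set.Ioi (0 : ℝ), volume {x | t < ‖g x‖} * ENNReal.ofReal (t ^ (twoSharp N s - 1))
      ≤ ENNReal.ofReal (twoSharp N s) * ∫⁻ t in Set.Ioi (0 : ℝ), ∫⁻ ξ : Eucl N,
          ENNReal.ofReal 4 * (Set.indicator (Set.Iio (c * ‖ξ‖ ^ ((N : ℝ) / 2)))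
            (fun t => ENNReal.ofReal (t ^ (q - 1))) t * ‖(𝓕 g : L2C N) ξ‖ₑ ^ 2) := by
        refine mul_le_mul_right ?_ _
        apply setLIntegral_mono' measurableSet_Ioi
        intro t ht
        have ht : 0 < t := ht
        refine (mul_le_mul_left (measure_superlevel_le hN hM ht g hg) _).trans (le_of_eq ?_)
        rw [mul_right_comm, ← ENNReal.ofReal_mul (by positivity),
          ← lintegral_const_mul' _ _ ENNReal.ofReal_ne_top]
        congr 1
        ext ξ
        by_cases h : t < c * ‖ξ‖ ^ ((N : ℝ) / 2)
        · rw [Set.indicator_of_mem (by exact h), Set.indicator_of_mem (by exact h), ← mul_assoc,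
            ← ENNReal.ofReal_mul (by norm_num), hp, mul_assoc, ← Real.rpow_add ht]
          congr 4
          ring
        · rw [Set.indicator_of_notMem (by exact h), Set.indicator_of_notMem (by exact h)]
          simp
    _ = ENNReal.ofReal (twoSharp N s) * ∫⁻ ξ : Eucl N, ∫⁻ t in Set.Ioi (0 : ℝ),
          ENNReal.ofReal 4 * (Set.indicator (Set.Iio (c * ‖ξ‖ ^ ((N : ℝ) / 2)))
            (fun t => ENNReal.ofReal (t ^ (q - 1))) t * ‖(𝓕 g : L2C N) ξ‖ₑ ^ 2) := by
        congr 1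
        apply lintegral_lintegral_swap
        apply Measurable.aemeasurable
        have hS : MeasurableSet {z : ℝ × Eucl N | z.1 < c * ‖z.2‖ ^ ((N : ℝ) / 2)} :=
          measurableSet_lt (by fun_prop) (by fun_prop)
        have h1 : Measurable (Set.indicator {z : ℝ × Eucl N | z.1 < c * ‖z.2‖ ^ ((N : ℝ) / 2)}
            fun z => ENNReal.ofReal (z.1 ^ (q - 1))) :=
          Measurable.indicator (by fun_prop) hS
        exact (h1.mul (hgm.comp measurable_snd)).const_mul _
    _ = ENNReal.ofReal (twoSharp N s) * ∫⁻ ξ : Eucl N, ENNReal.ofReal (4 * (c ^ q / q)) *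
          (ENNReal.ofReal (‖ξ‖ ^ (2 * s)) * ‖(𝓕 g : L2C N) ξ‖ₑ ^ 2) := by
        congr 2
        ext ξ
        have hm : Measurable (Set.indicator (Set.Iio (c * ‖ξ‖ ^ ((N : ℝ) / 2)))
            (fun t : ℝ => ENNReal.ofReal (t ^ (q - 1)))) :=
          Measurable.indicator (by fun_prop) measurableSet_Iio
        rw [lintegral_const_mul _ (hm.mul_const _), lintegral_mul_const _ hm,
          lintegral_rpow_Ioo hq0 (by positivity), ← mul_assoc, ← mul_assoc,
          ← ENNReal.ofReal_mul (by norm_num), ← ENNReal.ofReal_mul (by positivity),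
          Real.mul_rpow hc0.le (by positivity), ← Real.rpow_mul (norm_nonneg _)]
        congr 2
        -- Here the exponent `2 + 4s/N` is decisive: the weight comes out as exactly `‖ξ‖^(2s)`.
        rw [show (N : ℝ) / 2 * q = 2 * s by rw [hq]; field_simp; norm_num]
        ring
    _ = _ := by
        rw [lintegral_const_mul' _ _ ENNReal.ofReal_ne_top, ← mul_assoc,
          ← ENNReal.ofReal_mul (by rw [hp]; positivity)]
        congr 2
        ring

/-! ### Dilations. -/

theorem lintegral_comp_smul_eq (f : Eucl N → ENNReal) {l : ℝ} (hl : 0 < l) :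
    ∫⁻ x, f (l • x) = ENNReal.ofReal (l ^ N)⁻¹ * ∫⁻ x, f x := by
  have h1 : Measure.map (fun x : Eucl N => l • x) volume
      = ENNReal.ofReal |(l ^ Module.finrank ℝ (Eucl N))⁻¹| • volume :=
    Measure.map_addHaar_smul _ hl.ne'
  have h2 := (Homeomorph.smulOfNeZero l hl.ne' : Eucl N ≃ₜ Eucl N).measurableEmbedding.lintegral_map
    (μ := volume) f
  have h3 : ⇑(Homeomorph.smulOfNeZero l hl.ne' : Eucl N ≃ₜ Eucl N) = fun x => l • x := rfl
  rw [h3, h1, lintegral_smul_measure, finrank_euclideanSpace_fin, abs_of_pos (by positivity)] at h2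
  exact h2.symm

/-- The amplitude `c` is kept free: `c = 1` with `l > 1` lowers a positive mass, and `c = l^(N/2)`
preserves it. -/
theorem exists_dilation (u : L2 N) {l : ℝ} (hl : 0 < l) (c s : ℝ) :
    ∃ v : L2 N, (∀ᵐ x, v x = c * u (l • x)) ∧
      kinetic s v = ENNReal.ofReal (c ^ 2 * l ^ (2 * s) * (l ^ N)⁻¹) * kinetic s u := by
  have hm : MemLp (fun x => c * u (l • x)) 2 (volume : Measure (Eucl N)) :=
    (memLp_comp_smul (Lp.memLp u) hl.ne').const_mul c
  refine ⟨hm.toLp _, hm.coeFn_toLp, ?_⟩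
  have h1 : ∀ᵐ x, cplx (hm.toLp _) x = c * cplx u (l • x) := by
    filter_upwards [cplx_ae (hm.toLp _), hm.coeFn_toLp, ae_comp_smul (cplx_ae u) hl.ne']
      with x h1 h2 h3
    rw [h1, h2, h3]
    push_cast; rfl
  have h2 := fourier_ae_eq_dilation hl h1
  unfold kinetic
  rw [← lintegral_const_mul' _ _ ENNReal.ofReal_ne_top]
  -- The factor `l^(-2N)` is the square of the one in the dilated transform; the change of variables
  -- gives back `l^N`.
  calc _ = ∫⁻ ξ : Eucl N, (fun η : Eucl N => ENNReal.ofReal (c ^ 2 * l ^ (2 * s) * (l ^ (2 * N))⁻¹) *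
          (ENNReal.ofReal ((2 * Real.pi * ‖η‖) ^ (2 * s)) * ‖(𝓕 (cplx u) : L2C N) η‖ₑ ^ 2))
            (l⁻¹ • ξ) := by
        apply lintegral_congr_ae
        filter_upwards [h2] with ξ hξ
        rw [hξ, enorm_mul, mul_pow, ← mul_assoc, ← mul_assoc, ← ofReal_norm (_ : ℂ),
          Complex.norm_real, ← ENNReal.ofReal_pow (norm_nonneg _), Real.norm_eq_abs, sq_abs,
          ← ENNReal.ofReal_mul (by positivity), ← ENNReal.ofReal_mul (by positivity)]
        congr 2
        rw [norm_smul, Real.norm_of_nonneg (by positivity),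
          show 2 * Real.pi * ‖ξ‖ = l * (2 * Real.pi * (l⁻¹ * ‖ξ‖)) by field_simp,
          Real.mul_rpow hl.le (by positivity)]
        rw [mul_comm 2 N, pow_mul]
        field_simp
    _ = _ := by
        refine (lintegral_comp_smul_eq (fun η : Eucl N =>
          ENNReal.ofReal (c ^ 2 * l ^ (2 * s) * (l ^ (2 * N))⁻¹) *
          (ENNReal.ofReal ((2 * Real.pi * ‖η‖) ^ (2 * s)) * ‖(𝓕 (cplx u) : L2C N) η‖ₑ ^ 2))
            (inv_pos.2 hl)).trans ?_
        rw [lintegral_const_mul' _ _ ENNReal.ofReal_ne_top,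
          lintegral_const_mul' _ _ ENNReal.ofReal_ne_top, ← mul_assoc,
          ← ENNReal.ofReal_mul (by positivity)]
        congr 2
        rw [inv_pow, inv_inv, mul_comm 2 N, pow_mul]
        field_simp

/-! ### Frequency truncations of real functions. -/

/-- The ball is symmetric, so the cut-off keeps the relation `û(-ξ) = conj (û ξ)`, which
characterises real functions. -/
theorem exists_real_truncation (u : L2 N) (R : ℝ) :
    ∃ v : L2 N, cplx v = (𝓕⁻ (fourierCut R (cplx u)) : L2C N) := by
  set w : L2C N := 𝓕⁻ (fourierCut R (cplx u)) with hw
  have hFw : (𝓕 w : L2C N) = fourierCut R (cplx u) := FourierTransform.fourier_fourierInv_eq _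
  set w' : L2C N := (Complex.conjCLE : ℂ →L[ℝ] ℂ).compLp w with hw'
  have hc : ∀ᵐ x, w' x = starRingEnd ℂ (w x) :=
    ContinuousLinearMap.coeFn_compLp (Complex.conjCLE : ℂ →L[ℝ] ℂ) w
  have hu : ∀ᵐ x, cplx u x = starRingEnd ℂ (cplx u x) := by
    filter_upwards [cplx_ae u] with x hx
    rw [hx, Complex.conj_ofReal]
  have hneg : ∀ᵐ ξ : Eucl N, fourierCut R (cplx u) (-ξ) =
      Set.indicator (Metric.closedBall (0 : Eucl N) R) (𝓕 (cplx u) : L2C N) (-ξ) := by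
    have := ae_comp_smul (fourierCut_ae R (cplx u)) (neg_ne_zero.2 one_ne_zero : (-1 : ℝ) ≠ 0)
    simpa using this
  have key : w' = w := by
    have : (𝓕 w' : L2C N) = 𝓕 w := by
      apply Lp.ext
      filter_upwards [fourier_ae_eq_conj hc, fourier_ae_eq_conj hu, hneg, fourierCut_ae R (cplx u)]
        with ξ h1 h2 h3 h4
      rw [h1, hFw, h3, h4]
      by_cases h : ξ ∈ Metric.closedBall (0 : Eucl N) R
      · rw [Set.indicator_of_mem h, Set.indicator_of_mem (by simpa using h), h2]
      · rw [Set.indicator_of_notMem h, Set.indicator_of_notMem (by simpa using h), map_zero]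
    exact (Lp.fourierTransformₗᵢ (Eucl N) ℂ).injective this
  refine ⟨Complex.reCLM.compLp w, ?_⟩
  apply Lp.ext
  rw [key] at hc
  filter_upwards [cplx_ae (Complex.reCLM.compLp w), ContinuousLinearMap.coeFn_compLp Complex.reCLM w,
    hc] with x h1 h2 h3
  rw [h1, h2]
  exact Complex.conj_eq_iff_re.1 h3.symm

/-- The function obtained from `u` by cutting off the frequencies outside the ball of radius `R`. -/
def truncation (R : ℝ) (u : L2 N) : L2 N := (exists_real_truncation u R).choose

theorem cplx_truncation (R : ℝ) (u : L2 N) :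
    cplx (truncation R u) = (𝓕⁻ (fourierCut R (cplx u)) : L2C N) :=
  (exists_real_truncation u R).choose_spec

theorem fourier_truncation (R : ℝ) (u : L2 N) :
    (𝓕 (cplx (truncation R u)) : L2C N) = fourierCut R (cplx u) := by
  rw [cplx_truncation, FourierTransform.fourier_fourierInv_eq]

theorem enorm_fourierCut_le (R : ℝ) (g : L2C N) :
    ∀ᵐ ξ, ‖fourierCut R g ξ‖ₑ ≤ ‖(𝓕 g : L2C N) ξ‖ₑ := by
  filter_upwards [fourierCut_ae R g] with ξ h
  rw [h]
  exact enorm_indicator_le_enorm_self _ _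

theorem kinetic_truncation_le (s R : ℝ) (u : L2 N) : kinetic s (truncation R u) ≤ kinetic s u := by
  unfold kinetic
  rw [fourier_truncation]
  apply lintegral_mono_ae
  filter_upwards [enorm_fourierCut_le R (cplx u)] with ξ h
  gcongr

theorem norm_cplx (u : L2 N) : ‖cplx u‖ = ‖u‖ := by
  rw [Lp.norm_def, Lp.norm_def]
  congr 1
  apply eLpNorm_congr_norm_ae
  filter_upwards [cplx_ae u] with x hx
  rw [hx, Complex.norm_real]

theorem norm_truncation_le (R : ℝ) (u : L2 N) : ‖truncation R u‖ ≤ ‖u‖ := by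
  rw [← norm_cplx, ← norm_cplx u, ← Lp.norm_fourier_eq, ← Lp.norm_fourier_eq (cplx u),
    fourier_truncation]
  apply Lp.norm_le_norm_of_ae_le
  filter_upwards [enorm_fourierCut_le R (cplx u)] with ξ h
  exact enorm_le_iff_norm_le.1 h

theorem integral_sq_eq_norm_sq (u : L2 N) : ∫ x, (u x) ^ 2 = ‖u‖ ^ 2 := by
  rw [← real_inner_self_eq_norm_sq, L2.inner_def]
  congr 1
  ext x
  simp

theorem truncation_bounded {R : ℝ} (hR : 0 ≤ R) (u : L2 N) :
    ∃ B : ℝ, ∀ᵐ x, |truncation R u x| ≤ B := by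
  refine ⟨ballConst N * R ^ ((N : ℝ) / 2) * ‖cplx u‖, ?_⟩
  filter_upwards [lowFreq_bound hR (cplx u), cplx_ae (truncation R u)] with x h1 h2
  rw [← cplx_truncation, h2, Complex.norm_real] at h1
  exact h1

/-- By Plancherel the `L²` error is a tail of `∫ |û|²`, so the truncations converge in `L²`; a
subsequence converges a.e., as Fatou's lemma requires. -/
theorem exists_seq_truncation_tendsto (u : L2 N) :
    ∃ ns : ℕ → ℕ, ∀ᵐ x, Filter.Tendsto (fun i => truncation (ns i : ℝ) u x) Filter.atTop
      (nhds (u x)) := by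
  have h0 : Filter.Tendsto (fun n : ℕ => eLpNorm ((truncation (n : ℝ) u : Eucl N → ℝ) - (u : Eucl N → ℝ)) 2 volume)
      Filter.atTop (nhds 0) := by
    have h1 : ∀ n : ℕ, eLpNorm ((truncation (n : ℝ) u : Eucl N → ℝ) - (u : Eucl N → ℝ)) 2 volume =
        (∫⁻ ξ, Set.indicator {ξ : Eucl N | (n : ℝ) < ‖ξ‖}
          (fun ξ => ‖(𝓕 (cplx u) : L2C N) ξ‖ₑ ^ 2) ξ) ^ (1 / 2 : ℝ) := by
      intro n
      rw [← highFreq_sq, eLpNorm_eq_lintegral_rpow_enorm_toReal (by norm_num) (by norm_num)]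
      simp only [ENNReal.toReal_ofNat, ENNReal.rpow_ofNat]
      congr 1
      apply lintegral_congr_ae
      rw [← cplx_truncation]
      filter_upwards [cplx_ae u, cplx_ae (truncation (n : ℝ) u)] with x h2 h3
      rw [h2, h3, Pi.sub_apply, ← Complex.ofReal_sub, ← enorm_neg, neg_sub, ← ofReal_norm,
        ← ofReal_norm, Complex.norm_real]
    simp_rw [h1]
    have hgm : AEMeasurable (fun ξ => ‖(𝓕 (cplx u) : L2C N) ξ‖ₑ ^ 2) volume :=
      (Lp.aestronglyMeasurable _).enorm.pow_const 2
    have h2 : Filter.Tendsto (fun n : ℕ => ∫⁻ ξ, Set.indicator {ξ : Eucl N | (n : ℝ) < ‖ξ‖}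
          (fun ξ => ‖(𝓕 (cplx u) : L2C N) ξ‖ₑ ^ 2) ξ) Filter.atTop (nhds 0) := by
      rw [← lintegral_zero (μ := (volume : Measure (Eucl N)))]
      refine tendsto_lintegral_of_dominated_convergence' (fun ξ => ‖(𝓕 (cplx u) : L2C N) ξ‖ₑ ^ 2)
        (fun n => hgm.indicator (measurableSet_lt measurable_const measurable_norm))
        (fun n => ?_) (lintegral_enorm_sq_lt_top _).ne ?_
      · filter_upwards with ξ
        exact Set.indicator_le_self _ _ _
      · filter_upwards with ξ
        apply tendsto_const_nhds.congr'
        filter_upwards [Filter.eventually_ge_atTop ⌈‖ξ‖⌉₊] with n hn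
        rw [Set.indicator_of_notMem]
        simpa using Nat.ceil_le.1 hn
    have := (ENNReal.continuous_rpow_const (y := (1 / 2 : ℝ))).tendsto 0 |>.comp h2
    simpa [Function.comp_def] using this
  obtain ⟨ns, -, h⟩ := (tendstoInMeasure_of_tendsto_eLpNorm (by norm_num)
    (fun n => Lp.aestronglyMeasurable _) (Lp.aestronglyMeasurable _) h0).exists_seq_tendsto_ae
  exact ⟨ns, h⟩

/-- The constant depends on `v` only through the norm bound `M`, so one constant serves a function
and all its truncations. -/
theorem exists_lintegral_rpow_le {s : ℝ} (hN : 1 ≤ N) (hs : 0 < s) (M : ℝ) :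
    ∃ C : ℝ, ∀ v : L2 N, ‖v‖ ≤ M →
      ∫⁻ x, ENNReal.ofReal (|v x| ^ twoSharp N s) ≤ ENNReal.ofReal C * kinetic s v := by
  refine ⟨twoSharp N s * 4 * ((2 * ballConst N * (|M| + 1)) ^ (4 * s / N) / (4 * s / N)),
    fun v hv => ?_⟩
  have hv' : ‖cplx v‖ ≤ |M| + 1 := by rw [norm_cplx]; linarith [le_abs_self M]
  have h := gagliardo_nirenberg hN hs (by positivity) (cplx v) hv'
  have e : ∫⁻ x, ENNReal.ofReal (|v x| ^ twoSharp N s) =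
      ∫⁻ x, ENNReal.ofReal (‖cplx v x‖ ^ twoSharp N s) := by
    apply lintegral_congr_ae
    filter_upwards [cplx_ae v] with x hx
    rw [hx, Complex.norm_real, Real.norm_eq_abs]
  rw [e]
  refine h.trans (mul_le_mul_right ?_ _)
  apply lintegral_mono
  intro ξ
  dsimp only
  gcongr
  have := Real.pi_gt_three
  nlinarith [norm_nonneg ξ]

theorem eq_zero_of_kinetic_eq_zero {s : ℝ} (hN : 1 ≤ N) {u : L2 N} (h : kinetic s u = 0) :
    u = 0 := by
  have : Nonempty (Fin N) := ⟨⟨0, hN⟩⟩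
  have hm : AEMeasurable (fun ξ : Eucl N => ENNReal.ofReal ((2 * Real.pi * ‖ξ‖) ^ (2 * s)) *
      ‖(𝓕 (cplx u) : L2C N) ξ‖ₑ ^ 2) volume :=
    AEMeasurable.mul (by fun_prop) ((Lp.aestronglyMeasurable _).enorm.pow_const 2)
  rw [kinetic, lintegral_eq_zero_iff' hm] at h
  have h0 : ∀ᵐ ξ : Eucl N, ξ ≠ 0 := Measure.ae_ne volume 0
  have hF : (𝓕 (cplx u) : L2C N) = 0 := by
    rw [Lp.eq_zero_iff_ae_eq_zero]
    filter_upwards [h, h0] with ξ h1 h2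
    have h3 : 0 < ‖ξ‖ := norm_pos_iff.2 h2
    have h4 : ENNReal.ofReal ((2 * Real.pi * ‖ξ‖) ^ (2 * s)) ≠ 0 := by
      rw [Ne, ENNReal.ofReal_eq_zero, not_le]; positivity
    simpa [h4] using h1
  rw [← norm_eq_zero, ← norm_cplx, ← Lp.norm_fourier_eq, hF, norm_zero]

/-! ### Pointwise estimates on the primitive `F`. -/

theorem hasDerivAt_primitive {f : ℝ → ℝ} (hf : Continuous f) (t : ℝ) :
    HasDerivAt (primitive f) (f t) t :=
  (hf.integral_hasStrictDerivAt 0 t).hasDerivAt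

theorem continuous_primitive {f : ℝ → ℝ} (hf : Continuous f) : Continuous (primitive f) :=
  continuous_iff_continuousAt.2 fun t => (hasDerivAt_primitive hf t).continuousAt

theorem primitive_neg (f : ℝ → ℝ) (t : ℝ) : primitive (fun r => -f r) t = -primitive f t := by
  simp [primitive]

theorem primitive_zero (f : ℝ → ℝ) : primitive f 0 = 0 := by simp [primitive]

/-- Near the origin the three regimes reduce to the same linear bound. For large `t`, control of `F`
will come from the strict inequality instead. -/
theorem GrowthCondition.exists_linear_bound {s : ℝ} {f : ℝ → ℝ} (hs : 0 < s)
    (hf : GrowthCondition N s f) : ∃ C : ℝ, 0 ≤ C ∧ ∀ t : ℝ, |t| ≤ 1 → |f t| ≤ C * |t| := by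
  rcases lt_trichotomy (N : ℝ) (2 * s) with h | h | h
  · obtain ⟨C, hC, hb⟩ := hf.sub h
    exact ⟨C, hC.le, fun t ht => hb t (abs_le.1 ht)⟩
  · obtain ⟨C, hC, hb⟩ := hf.crit h 2 le_rfl (|alphaN N| + 1) (by linarith [le_abs_self (alphaN N)])
    refine ⟨C * Real.exp (|alphaN N| + 1), by positivity, fun t ht => (hb t).trans ?_⟩
    have h1 : Real.exp ((|alphaN N| + 1) * t ^ 2) ≤ Real.exp (|alphaN N| + 1) := by
      apply Real.exp_le_exp.2
      have : t ^ 2 ≤ 1 := by rw [← sq_abs]; exact pow_le_one₀ (abs_nonneg _) ht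
      have := abs_nonneg (alphaN N)
      nlinarith
    rw [show (2 : ℝ) - 1 = 1 by norm_num, Real.rpow_one]
    calc C * (|t| + |t| * (Real.exp ((|alphaN N| + 1) * t ^ 2) - 1))
        = C * |t| * Real.exp ((|alphaN N| + 1) * t ^ 2) := by ring
      _ ≤ C * |t| * Real.exp (|alphaN N| + 1) := by gcongr
      _ = _ := by ring
  · obtain ⟨C, hC, hb⟩ := hf.super h
    refine ⟨2 * C, by positivity, fun t ht => (hb t).trans ?_⟩
    have h1 : |t| ^ (2 * (N : ℝ) / (N - 2 * s) - 1) ≤ |t| := by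
      apply Real.rpow_le_self_of_le_one (abs_nonneg _) ht
      have : 2 ≤ 2 * (N : ℝ) / (N - 2 * s) := by
        rw [le_div_iff₀ (by linarith)]; linarith
      linarith
    nlinarith

theorem abs_primitive_le_sq {f : ℝ → ℝ} {C : ℝ} (hC : 0 ≤ C)
    (hb : ∀ t : ℝ, |t| ≤ 1 → |f t| ≤ C * |t|) {t : ℝ} (ht : |t| ≤ 1) :
    |primitive f t| ≤ C * t ^ 2 := by
  have h := intervalIntegral.norm_integral_le_of_norm_le_const (f := f) (a := 0) (b := t)
    (C := C * |t|) (fun x hx => by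
      have hx' : |x| ≤ |t| := by
        rcases Set.mem_uIoc.1 hx with h | h
        · rw [abs_of_pos h.1, abs_of_pos (h.1.trans_le h.2)]; exact h.2
        · rw [abs_of_nonpos h.2, abs_of_neg (h.1.trans_le h.2)]; linarith
      exact (hb x (hx'.trans ht)).trans (by gcongr))
  rw [sub_zero] at h
  calc |primitive f t| ≤ C * |t| * |t| := h
    _ = C * t ^ 2 := by rw [mul_assoc, abs_mul_abs_self, sq]

theorem exists_primitive_le_sq_of_bounded {f : ℝ → ℝ} (hf : Continuous f) {C : ℝ} (hC : 0 ≤ C)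
    (hb : ∀ t : ℝ, |t| ≤ 1 → |f t| ≤ C * |t|) (B : ℝ) :
    ∃ K : ℝ, ∀ t : ℝ, |t| ≤ B → |primitive f t| ≤ K * t ^ 2 := by
  obtain ⟨K, hK⟩ := (isCompact_Icc (a := -B) (b := B)).exists_bound_of_continuousOn
    (continuous_primitive hf).continuousOn
  refine ⟨C + |K|, fun t ht => ?_⟩
  rcases le_total |t| 1 with h | h
  · exact (abs_primitive_le_sq hC hb h).trans (by have := abs_nonneg K; gcongr; linarith)
  · have h1 : |primitive f t| ≤ |K| := (hK t (abs_le.1 ht)).trans (le_abs_self K)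
    have h2 : 1 ≤ t ^ 2 := by rw [← sq_abs]; exact one_le_pow₀ h
    have := abs_nonneg K
    nlinarith

/-- The derivative is `a^(-p-1) (f(at) at - p F(at))`. -/
theorem strictMonoOn_primitive_rpow {f : ℝ → ℝ} (hf : Continuous f) {p : ℝ}
    (hp : ∀ t : ℝ, t ≠ 0 → p * primitive f t < f t * t) {t : ℝ} (ht : t ≠ 0) :
    StrictMonoOn (fun a : ℝ => primitive f (a * t) * a ^ (-p)) (Set.Ioi 0) := by
  have hd : ∀ a ∈ Set.Ioi (0 : ℝ), HasDerivAt (fun a : ℝ => primitive f (a * t) * a ^ (-p))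
      (f (a * t) * t * a ^ (-p) + primitive f (a * t) * (-p * a ^ (-p - 1))) a := by
    intro a ha
    have h1 : HasDerivAt (fun a : ℝ => primitive f (a * t)) (f (a * t) * t) a := by
      have := (hasDerivAt_primitive hf (a * t)).comp a ((hasDerivAt_id a).mul_const t)
      simpa [Function.comp_def] using this
    exact h1.mul (Real.hasDerivAt_rpow_const (Or.inl (ne_of_gt ha)))
  apply strictMonoOn_of_deriv_pos (convex_Ioi 0)
  · exact fun a ha => (hd a ha).continuousAt.continuousWithinAt
  · intro a ha
    rw [interior_Ioi] at ha
    have ha' : 0 < a := ha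
    rw [(hd a ha).deriv]
    have h1 := hp (a * t) (mul_ne_zero ha'.ne' ht)
    have h2 : a ^ (-p) = a ^ (-p - 1) * a := by
      rw [← Real.rpow_add_one ha'.ne']; congr 1; ring
    rw [h2]
    have h3 : 0 < a ^ (-p - 1) := Real.rpow_pos_of_pos ha' _
    have : f (a * t) * t * (a ^ (-p - 1) * a) + primitive f (a * t) * (-p * a ^ (-p - 1))
        = a ^ (-p - 1) * (f (a * t) * (a * t) - p * primitive f (a * t)) := by ring
    rw [this]
    exact mul_pos h3 (by linarith)

theorem rpow_mul_primitive_lt {f : ℝ → ℝ} (hf : Continuous f) {p : ℝ}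
    (hp : ∀ t : ℝ, t ≠ 0 → p * primitive f t < f t * t) {t a : ℝ} (ht : t ≠ 0) (ha : 1 < a) :
    a ^ p * primitive f t < primitive f (a * t) := by
  have ha0 : 0 < a := one_pos.trans ha
  have h := strictMonoOn_primitive_rpow hf hp ht (Set.mem_Ioi.2 one_pos) (Set.mem_Ioi.2 ha0) ha
  simp only [one_mul, Real.one_rpow, mul_one, Real.rpow_neg ha0.le] at h
  rwa [← div_eq_mul_inv, lt_div_iff₀ (Real.rpow_pos_of_pos ha0 p), mul_comm] at h

theorem primitive_lt_rpow_mul {f : ℝ → ℝ} (hf : Continuous f) {p : ℝ}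
    (hp : ∀ t : ℝ, t ≠ 0 → p * primitive f t < f t * t) {t a : ℝ} (ht : t ≠ 0) (ha0 : 0 < a)
    (ha : a < 1) : primitive f (a * t) < a ^ p * primitive f t := by
  have h := strictMonoOn_primitive_rpow hf hp ht (Set.mem_Ioi.2 ha0) (Set.mem_Ioi.2 one_pos) ha
  simp only [one_mul, Real.one_rpow, mul_one, Real.rpow_neg ha0.le] at h
  rwa [← div_eq_mul_inv, div_lt_iff₀ (Real.rpow_pos_of_pos ha0 p), mul_comm (primitive f t)] at h

/-- For `|t| > 1`, scaling from the point `t/|t| = ±1` gives `F(t) > |t|^p F(±1) ≥ -C |t|^p`; for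
`|t| ≤ 1` the linear bound on `f` suffices. -/
theorem exists_lower_bound {f : ℝ → ℝ} (hf : Continuous f) {p C : ℝ} (hC : 0 ≤ C)
    (hb : ∀ t : ℝ, |t| ≤ 1 → |f t| ≤ C * |t|)
    (hp : ∀ t : ℝ, t ≠ 0 → p * primitive f t < f t * t) :
    ∃ K : ℝ, 0 ≤ K ∧ ∀ t : ℝ, -(K * (t ^ 2 + |t| ^ p)) ≤ primitive f t := by
  refine ⟨C, hC, fun t => ?_⟩
  have hpos : 0 ≤ |t| ^ p := Real.rpow_nonneg (abs_nonneg _) _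
  rcases le_or_gt |t| 1 with h | h
  · have := (abs_le.1 (abs_primitive_le_sq hC hb h)).1
    nlinarith [mul_nonneg hC hpos]
  · have ht : t ≠ 0 := by rintro rfl; simp at h; linarith
    have ht' : 0 < |t| := abs_pos.2 ht
    have h1 := rpow_mul_primitive_lt hf hp (t := t / |t|) (by positivity) h
    rw [mul_div_cancel₀ _ ht'.ne'] at h1
    have habs : abs (t / |t|) = 1 := by rw [abs_div, abs_abs, div_self ht'.ne']
    have h2 := (abs_le.1 (abs_primitive_le_sq hC hb habs.le)).1
    have h3 : (t / |t|) ^ 2 = 1 := by rw [← sq_abs, habs, one_pow]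
    rw [h3] at h2
    nlinarith [mul_nonneg hC (sq_nonneg t), mul_nonneg hpos (by linarith : 0 ≤ primitive f (t / |t|) + C)]

/-! ### The energy at the critical mass. -/

theorem integrable_sq (u : L2 N) : Integrable (fun x => (u x) ^ 2) :=
  (memLp_two_iff_integrable_sq (Lp.aestronglyMeasurable _)).1 (Lp.memLp u)

theorem aestronglyMeasurable_primitive {f : ℝ → ℝ} (hf : Continuous f) (u : L2 N) :
    AEStronglyMeasurable (fun x => primitive f (u x)) volume :=
  (continuous_primitive hf).comp_aestronglyMeasurable (Lp.aestronglyMeasurable u)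

theorem twoSharp_pos {s : ℝ} (hs : 0 < s) : 0 < twoSharp N s := by
  unfold twoSharp; positivity

theorem aestronglyMeasurable_abs_rpow (u : L2 N) (p : ℝ) :
    AEStronglyMeasurable (fun x => |u x| ^ p) volume :=
  (((Lp.aestronglyMeasurable u).aemeasurable.abs).pow_const p).aestronglyMeasurable

theorem integral_abs_rpow {s : ℝ} {C : ℝ} {v : L2 N}
    (h : ∫⁻ x, ENNReal.ofReal (|v x| ^ twoSharp N s) ≤ ENNReal.ofReal C * kinetic s v)
    (hv : kinetic s v < ⊤) :
    Integrable (fun x => |v x| ^ twoSharp N s) ∧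
      ∫ x, |v x| ^ twoSharp N s ≤ |C| * (kinetic s v).toReal := by
  have hm := aestronglyMeasurable_abs_rpow v (twoSharp N s)
  have hnn : ∀ x, 0 ≤ |v x| ^ twoSharp N s := fun x => Real.rpow_nonneg (abs_nonneg _) _
  have h1 : ENNReal.ofReal C * kinetic s v < ⊤ := ENNReal.mul_lt_top ENNReal.ofReal_lt_top hv
  constructor
  · refine ⟨hm, ?_⟩
    rw [hasFiniteIntegral_iff_ofReal (by filter_upwards with x using hnn x)]
    exact h.trans_lt h1
  · rw [integral_eq_lintegral_of_nonneg_ae (by filter_upwards with x using hnn x) hm]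
    calc _ ≤ (ENNReal.ofReal C * kinetic s v).toReal := ENNReal.toReal_mono h1.ne h
      _ = max C 0 * (kinetic s v).toReal := by
        rw [ENNReal.toReal_mul, ENNReal.toReal_ofReal']
      _ ≤ _ := by
        gcongr
        exact max_le (le_abs_self C) (abs_nonneg C)

theorem J_eq {s : ℝ} (hs : 0 < s) (f : ℝ → ℝ) {u : L2 N} (hu : MemHs s u) :
    J N s f u = 1 / 2 * (kinetic s u).toReal - ∫ x, primitive f (u x) := by
  rw [J, integral_DsSq hs hu]

theorem zero_ae : ∀ᵐ x, (0 : L2 N) x = 0 := Lp.coeFn_zero _ _ _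

theorem kinetic_zero (s : ℝ) : kinetic s (0 : L2 N) = 0 := by
  have h : cplx (0 : L2 N) = 0 := by rw [← norm_eq_zero, norm_cplx, norm_zero]
  have h2 : (𝓕 (0 : L2C N) : L2C N) = 0 := by rw [← norm_eq_zero, Lp.norm_fourier_eq, norm_zero]
  rw [kinetic, h, h2, ← lintegral_zero (μ := (volume : Measure (Eucl N)))]
  simp

theorem zero_mem_D0 (s : ℝ) {r : ℝ} (hr : 0 ≤ r) : (0 : L2 N) ∈ D0 N s r := by
  refine ⟨memHs_iff.2 (by rw [kinetic_zero]; exact ENNReal.zero_lt_top), ?_⟩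
  rw [integral_sq_eq_norm_sq, norm_zero]
  simpa using hr

theorem J_zero {s : ℝ} (hs : 0 < s) (f : ℝ → ℝ) : J N s f 0 = 0 := by
  rw [J_eq hs f (memHs_iff.2 (by rw [kinetic_zero]; exact ENNReal.zero_lt_top)), kinetic_zero]
  have : ∫ x, primitive f ((0 : L2 N) x) = 0 := by
    rw [← integral_zero (Eucl N) ℝ]
    apply integral_congr_ae
    filter_upwards [zero_ae (N := N)] with x hx
    rw [hx, primitive_zero]
  rw [this]
  simp

theorem integral_comp_smul' (g : Eucl N → ℝ) {l : ℝ} (hl : 0 < l) :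
    ∫ x, g (l • x) = (l ^ N)⁻¹ * ∫ x, g x := by
  have := Measure.integral_comp_smul (volume : Measure (Eucl N)) g l
  rwa [finrank_euclideanSpace_fin, abs_of_pos (by positivity), smul_eq_mul] at this

theorem J_nonneg_of_lt_rhoStar0 {s : ℝ} {f : ℝ → ℝ} {r : ℝ}
    (hr : rhoStar0 N s f = r) (hr0 : 0 < r) {v : L2 N} (hv : MemHs s v)
    (hvr : ∫ x, (v x) ^ 2 < r) : 0 ≤ J N s f v := by
  by_contra hneg
  rw [not_le] at hneg
  -- The maximum with `r/2` keeps `ρ` positive even when `v` has mass zero.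
  set ρ := max (∫ x, (v x) ^ 2) (r / 2) with hρ
  have hρr : ρ < r := max_lt hvr (by linarith)
  have hρ0 : 0 < ρ := lt_max_of_lt_right (by linarith)
  have hm : m0 N s f ρ < 0 :=
    lt_of_le_of_lt
      (sInf_le (Set.mem_image_of_mem (fun u : L2 N => (J N s f u : EReal))
        (show v ∈ D0 N s ρ from ⟨hv, le_max_left _ _⟩))) (by exact_mod_cast hneg)
  have h : rhoStar0 N s f ≤ ρ := sInf_le ⟨ρ, ⟨hρ0, hm⟩, rfl⟩
  rw [hr] at h
  exact absurd (EReal.coe_le_coe_iff.1 h) (not_le.2 hρr)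

/-- For `l > 1` the dilation `v(l ·)` has mass below `r`, hence nonnegative energy; let `l` decrease
to `1`. The scaling of `∫ F(v)` holds without integrability, since the default value `0` scales as
well. -/
theorem J_nonneg_of_mem_D0 {s : ℝ} (hN : 1 ≤ N) (hs : 0 < s) {f : ℝ → ℝ} {r : ℝ}
    (hr : rhoStar0 N s f = r) (hr0 : 0 < r) {v : L2 N} (hv : v ∈ D0 N s r) : 0 ≤ J N s f v := by
  obtain ⟨hvH, hvm⟩ := hv
  have hk := memHs_iff.1 hvH
  rw [J_eq hs f hvH]
  set K := (kinetic s v).toReal with hK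
  set P := ∫ x, primitive f (v x) with hP
  have key : ∀ l : ℝ, 1 < l → P ≤ 1 / 2 * (l ^ (2 * s) * K) := by
    intro l hl
    have hl0 : 0 < l := one_pos.trans hl
    obtain ⟨w, hw, hwk⟩ := exists_dilation v hl0 1 s
    simp only [one_mul, one_pow] at hw hwk
    have hwH : MemHs s w :=
      memHs_iff.2 (hwk ▸ ENNReal.mul_lt_top ENNReal.ofReal_lt_top hk)
    have hwm : ∫ x, (w x) ^ 2 = (l ^ N)⁻¹ * ∫ x, (v x) ^ 2 := by
      rw [← integral_comp_smul' (fun x => (v x) ^ 2) hl0]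
      apply integral_congr_ae
      filter_upwards [hw] with x hx
      rw [hx]
    have hwP : ∫ x, primitive f (w x) = (l ^ N)⁻¹ * P := by
      rw [hP, ← integral_comp_smul' (fun x => primitive f (v x)) hl0]
      apply integral_congr_ae
      filter_upwards [hw] with x hx
      rw [hx]
    have hlN : (l ^ N)⁻¹ < 1 := inv_lt_one_of_one_lt₀ (one_lt_pow₀ hl (by omega))
    have hlN0 : 0 < (l ^ N)⁻¹ := by positivity
    have hlt : ∫ x, (w x) ^ 2 < r := by
      rw [hwm]
      calc (l ^ N)⁻¹ * ∫ x, (v x) ^ 2 ≤ (l ^ N)⁻¹ * r := by gcongr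
        _ < 1 * r := by gcongr
        _ = r := one_mul r
    have h := J_nonneg_of_lt_rhoStar0 hr hr0 hwH hlt
    rw [J_eq hs f hwH, hwk, hwP, ENNReal.toReal_mul, ENNReal.toReal_ofReal (by positivity), ← hK] at h
    have h2 : 0 ≤ (l ^ N)⁻¹ * (1 / 2 * (l ^ (2 * s) * K) - P) := by linarith
    linarith [nonneg_of_mul_nonneg_right h2 hlN0]
  have hlim : Filter.Tendsto (fun l : ℝ => 1 / 2 * (l ^ (2 * s) * K)) (nhdsWithin 1 (Set.Ioi 1))
      (nhds (1 / 2 * ((1 : ℝ) ^ (2 * s) * K))) := by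
    apply Filter.Tendsto.mono_left _ nhdsWithin_le_nhds
    exact ((Real.continuousAt_rpow_const 1 (2 * s) (Or.inl one_ne_zero)).mul_const K).const_mul _
  have := ge_of_tendsto hlim (by filter_upwards [self_mem_nhdsWithin] with l hl using key l hl)
  rw [Real.one_rpow, one_mul] at this
  linarith

/-- Truncations stay in `D0` and are bounded, so `F` of them is integrable, and `J ≥ 0` bounds its
integral by half the kinetic energy of `w`. Adding `K (t² + |t|^p)` makes the integrand nonnegative,
and Fatou's lemma passes to `w`. -/
theorem integrable_primitive_of_lower_bound {s : ℝ} (hN : 1 ≤ N) (hs : 0 < s) {f : ℝ → ℝ}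
    (hf : Continuous f) {C K r : ℝ} (hC : 0 ≤ C) (hb : ∀ t : ℝ, |t| ≤ 1 → |f t| ≤ C * |t|)
    (hK : 0 ≤ K) (hlow : ∀ t : ℝ, -(K * (t ^ 2 + |t| ^ twoSharp N s)) ≤ primitive f t)
    (hJ : ∀ v ∈ D0 N s r, 0 ≤ J N s f v) {w : L2 N} (hw : w ∈ D0 N s r) :
    Integrable (fun x => primitive f (w x)) := by
  obtain ⟨hwH, hwm⟩ := hw
  have hwk := memHs_iff.1 hwH
  obtain ⟨A, hA⟩ := exists_lintegral_rpow_le (s := s) hN hs ‖w‖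
  set p := twoSharp N s with hp
  set G : ℝ → ℝ := fun t => primitive f t + K * (t ^ 2 + |t| ^ p) with hG
  have hG0 : ∀ t, 0 ≤ G t := fun t => by have := hlow t; simp only [hG]; linarith
  have hGc : Continuous G := by
    have h1 : Continuous fun t : ℝ => |t| ^ p :=
      continuous_abs.rpow_const fun t => Or.inr (twoSharp_pos hs).le
    exact (continuous_primitive hf).add (continuous_const.mul ((continuous_pow 2).add h1))
  set L := 1 / 2 * (kinetic s w).toReal + K * (‖w‖ ^ 2 + |A| * (kinetic s w).toReal) with hL
  have hbound : ∀ n : ℕ, ∫⁻ x, ENNReal.ofReal (G (truncation (n : ℝ) w x)) ≤ ENNReal.ofReal L := by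
    intro n
    set v := truncation (n : ℝ) w with hv
    have hvk : kinetic s v ≤ kinetic s w := kinetic_truncation_le s n w
    have hvk' : (kinetic s v).toReal ≤ (kinetic s w).toReal := ENNReal.toReal_mono hwk.ne hvk
    have hvn : ‖v‖ ≤ ‖w‖ := norm_truncation_le n w
    have hvH : MemHs s v := memHs_iff.2 (hvk.trans_lt hwk)
    have hvsq : ∫ x, (v x) ^ 2 ≤ ‖w‖ ^ 2 := by
      rw [integral_sq_eq_norm_sq]; gcongr
    have hvD : v ∈ D0 N s r := ⟨hvH, by rw [← integral_sq_eq_norm_sq] at hvsq; exact hvsq.trans hwm⟩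
    obtain ⟨hi1, hle1⟩ := integral_abs_rpow (hA v hvn) (hvk.trans_lt hwk)
    obtain ⟨B, hB⟩ := truncation_bounded (Nat.cast_nonneg n) w
    obtain ⟨D, hD⟩ := exists_primitive_le_sq_of_bounded hf hC hb B
    have hi2 : Integrable (fun x => primitive f (v x)) := by
      refine ((integrable_sq v).const_mul D).mono' (aestronglyMeasurable_primitive hf v) ?_
      filter_upwards [hB] with x hx using hD _ hx
    have hi3 : Integrable (fun x => K * ((v x) ^ 2 + |v x| ^ p)) :=
      ((integrable_sq v).add hi1).const_mul K
    have hJv := hJ v hvD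
    rw [J_eq hs f hvH] at hJv
    have hlin := ofReal_integral_eq_lintegral_ofReal (hi2.add hi3)
      (by filter_upwards with x using hG0 (v x))
    refine hlin.symm.le.trans ?_
    apply ENNReal.ofReal_le_ofReal
    rw [integral_add' hi2 hi3, integral_const_mul, integral_add (integrable_sq v) hi1, hL]
    have h1 : |A| * (kinetic s v).toReal ≤ |A| * (kinetic s w).toReal := by gcongr
    have h2 : K * ((∫ x, (v x) ^ 2) + ∫ x, |v x| ^ p) ≤
        K * (‖w‖ ^ 2 + |A| * (kinetic s w).toReal) := by
      gcongr
      exact hle1.trans h1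
    linarith
  obtain ⟨ns, hns⟩ := exists_seq_truncation_tendsto w
  have hfatou : ∫⁻ x, ENNReal.ofReal (G (w x)) ≤ ENNReal.ofReal L := by
    calc ∫⁻ x, ENNReal.ofReal (G (w x))
        = ∫⁻ x, Filter.liminf (fun i => ENNReal.ofReal (G (truncation (ns i : ℝ) w x)))
            Filter.atTop := by
          apply lintegral_congr_ae
          filter_upwards [hns] with x hx
          exact ((ENNReal.continuous_ofReal.comp hGc).tendsto (w x) |>.comp hx).liminf_eq.symm
      _ ≤ Filter.liminf (fun i => ∫⁻ x, ENNReal.ofReal (G (truncation (ns i : ℝ) w x)))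
            Filter.atTop :=
          lintegral_liminf_le' fun i =>
            (hGc.comp_aestronglyMeasurable (Lp.aestronglyMeasurable _)).aemeasurable.ennreal_ofReal
      _ ≤ ENNReal.ofReal L := by
          refine Filter.liminf_le_of_frequently_le' ?_
          exact Filter.Frequently.of_forall fun i => hbound (ns i)
  have hGi : Integrable (fun x => G (w x)) := by
    refine ⟨hGc.comp_aestronglyMeasurable (Lp.aestronglyMeasurable _), ?_⟩
    rw [hasFiniteIntegral_iff_ofReal (by filter_upwards with x using hG0 (w x))]
    exact hfatou.trans_lt ENNReal.ofReal_lt_top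
  obtain ⟨hi1, -⟩ := integral_abs_rpow (hA w le_rfl) hwk
  have hi3 : Integrable (fun x => K * ((w x) ^ 2 + |w x| ^ p)) :=
    ((integrable_sq w).add hi1).const_mul K
  refine (hGi.sub hi3).congr ?_
  filter_upwards with x
  simp [hG]

/-- If the mass-preserving dilation by `l` increases the potential energy strictly more than the
kinetic energy, then a minimiser of `J` at the critical mass vanishes. -/
theorem eq_zero_of_isMinOn {s : ℝ} (hN : 1 ≤ N) (hs : 0 < s) {f : ℝ → ℝ}
    {r l : ℝ} (hr0 : 0 < r) (hl : 0 < l) (hJ : ∀ v ∈ D0 N s r, 0 ≤ J N s f v) {u : L2 N}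
    (hu : u ∈ D0 N s r) (hmin : IsMinOn (J N s f) (D0 N s r) u)
    (hlt : ∀ t : ℝ, t ≠ 0 → (l ^ ((N : ℝ) / 2)) ^ twoSharp N s * primitive f t <
      primitive f (l ^ ((N : ℝ) / 2) * t))
    (hint : ∀ w ∈ D0 N s r, (∀ᵐ x, w x = l ^ ((N : ℝ) / 2) * u (l • x)) →
      Integrable (fun x => primitive f (u x)) → Integrable (fun x => primitive f (w x))) :
    u = 0 := by
  by_contra hu0
  have hN' : (0 : ℝ) < N := by exact_mod_cast hN
  obtain ⟨huH, hum⟩ := hu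
  have hk := memHs_iff.1 huH
  have hJu : J N s f u ≤ 0 := by
    have := hmin (zero_mem_D0 s hr0.le)
    rwa [Set.mem_ofPred_eq, J_zero hs f] at this
  rw [J_eq hs f huH] at hJu
  have hK : 0 < (kinetic s u).toReal :=
    ENNReal.toReal_pos (fun h => hu0 (eq_zero_of_kinetic_eq_zero hN h)) hk.ne
  -- A vanishing potential term would leave `J u = K(u)/2 > 0`. This also excludes the default value
  -- `0`, so `F(u)` is integrable.
  have hP : ∫ x, primitive f (u x) ≠ 0 := by intro h; rw [h] at hJu; linarith
  have hi : Integrable (fun x => primitive f (u x)) := by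
    by_contra h; exact hP (integral_undef h)
  set m := l ^ ((N : ℝ) / 2) with hm
  have hm0 : 0 < m := Real.rpow_pos_of_pos hl _
  have hm2 : m ^ 2 = l ^ N := by
    rw [hm, ← Real.rpow_natCast, ← Real.rpow_mul hl.le, ← Real.rpow_natCast]
    congr 1; push_cast; ring
  obtain ⟨w, hw, hwk⟩ := exists_dilation u hl m s
  have e1 : m ^ 2 * l ^ (2 * s) * (l ^ N)⁻¹ = l ^ (2 * s) := by
    rw [hm2]; field_simp
  rw [e1] at hwk
  have hwH : MemHs s w := memHs_iff.2 (hwk ▸ ENNReal.mul_lt_top ENNReal.ofReal_lt_top hk)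
  have hwm : ∫ x, (w x) ^ 2 = ∫ x, (u x) ^ 2 := by
    have : ∫ x, (w x) ^ 2 = ∫ x, (fun y => m ^ 2 * (u y) ^ 2) (l • x) := by
      apply integral_congr_ae
      filter_upwards [hw] with x hx
      rw [hx, mul_pow]
    rw [this, integral_comp_smul' (fun y => m ^ 2 * (u y) ^ 2) hl, integral_const_mul, ← mul_assoc, hm2,
      inv_mul_cancel₀ (by positivity), one_mul]
  have hwD : w ∈ D0 N s r := ⟨hwH, hwm ▸ hum⟩
  have hwi := hint w hwD hw hi
  have hui : Integrable (fun x => primitive f (m * u x)) := by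
    have h1 : Integrable (fun x => (fun y => primitive f (m * u y)) (l • x)) := by
      refine hwi.congr ?_
      filter_upwards [hw] with x hx
      rw [hx]
    exact (integrable_comp_smul_iff volume (fun y => primitive f (m * u y)) hl.ne').1 h1
  have hwP : ∫ x, primitive f (w x) = (l ^ N)⁻¹ * ∫ x, primitive f (m * u x) := by
    rw [← integral_comp_smul' (fun x => primitive f (m * u x)) hl]
    apply integral_congr_ae
    filter_upwards [hw] with x hx
    rw [hx]
  -- Mass-criticality: after the Jacobian `l^(-N)`, the potential bound scales like the kinetic
  -- energy.
  have hmp : m ^ twoSharp N s = l ^ N * l ^ (2 * s) := by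
    rw [hm, ← Real.rpow_mul hl.le, ← Real.rpow_natCast l N, ← Real.rpow_add hl, twoSharp]
    congr 1
    field_simp
    ring
  have hnn : ∀ x, 0 ≤ primitive f (m * u x) - m ^ twoSharp N s * primitive f (u x) := by
    intro x
    rcases eq_or_ne (u x) 0 with h | h
    · simp [h, primitive_zero]
    · have := hlt _ h; linarith
  have hpos : 0 < ∫ x, (primitive f (m * u x) - m ^ twoSharp N s * primitive f (u x)) := by
    rw [integral_pos_iff_support_of_nonneg hnn (hui.sub (hi.const_mul _))]
    have hsub : {x | u x ≠ 0} ⊆ Function.support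
        (fun x => primitive f (m * u x) - m ^ twoSharp N s * primitive f (u x)) := by
      intro x hx
      have := hlt _ hx
      exact (sub_pos.2 this).ne'
    refine lt_of_lt_of_le ?_ (measure_mono hsub)
    rw [pos_iff_ne_zero]
    intro h
    exact hu0 ((Lp.eq_zero_iff_ae_eq_zero).2 (by simpa [Filter.EventuallyEq, ae_iff] using h))
  rw [integral_sub hui (hi.const_mul _), integral_const_mul, hmp] at hpos
  have hJw := hJ w hwD
  rw [J_eq hs f hwH, hwk, hwP, ENNReal.toReal_mul, ENNReal.toReal_ofReal (by positivity)] at hJw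
  have hlN : 0 < l ^ N := by positivity
  have h1 : l ^ (2 * s) * ∫ x, primitive f (u x) < (l ^ N)⁻¹ * ∫ x, primitive f (m * u x) := by
    rw [inv_mul_eq_div, lt_div_iff₀ hlN]
    linarith
  have h2 : l ^ (2 * s) * (1 / 2 * (kinetic s u).toReal - ∫ x, primitive f (u x)) ≤ 0 :=
    mul_nonpos_of_nonneg_of_nonpos (by positivity) hJu
  linarith

end MassCritical

end

theorem theorem1p6 (N : ℕ) (hN : 1 ≤ N) (s : ℝ) (hs : 0 < s) (f : ℝ → ℝ)
    (hf : MassCritical.GrowthCondition N s f)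
    (hpos : 0 < MassCritical.rhoStar0 N s f)
    (hfin : MassCritical.rhoStar0 N s f < ⊤)
    (hstrict :
      (∀ t : ℝ, t ≠ 0 →
        MassCritical.twoSharp N s * MassCritical.primitive f t < f t * t) ∨
      (∀ t : ℝ, t ≠ 0 →
        f t * t < MassCritical.twoSharp N s * MassCritical.primitive f t)) :
    ¬ ∃ u ∈ MassCritical.D0 N s (MassCritical.rhoStar0 N s f).toReal,
      u ≠ 0 ∧
        IsMinOn (MassCritical.J N s f)
          (MassCritical.D0 N s (MassCritical.rhoStar0 N s f).toReal) u := by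
  open MassCritical in
  rintro ⟨u, hu, hu0, hmin⟩
  set r := (rhoStar0 N s f).toReal with hrd
  have hr : rhoStar0 N s f = r := (EReal.coe_toReal hfin.ne (ne_bot_of_gt hpos)).symm
  have hr0 : 0 < r := by rw [hr] at hpos; exact_mod_cast hpos
  have hJ : ∀ v ∈ D0 N s r, 0 ≤ J N s f v := fun v hv => J_nonneg_of_mem_D0 hN hs hr hr0 hv
  obtain ⟨C, hC, hb⟩ := hf.exists_linear_bound hs
  have hc := hf.continuous
  rcases hstrict with h | h
  · obtain ⟨K, hK, hlow⟩ := exists_lower_bound hc hC hb h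
    -- Any dilation factor `l > 1` would do; `l = 2` is taken.
    have hm : (1 : ℝ) < 2 ^ ((N : ℝ) / 2) := Real.one_lt_rpow (by norm_num) (by positivity)
    exact hu0 (eq_zero_of_isMinOn hN hs hr0 two_pos hJ hu hmin
      (fun t ht => rpow_mul_primitive_lt hc h ht hm)
      fun w hw _ _ => integrable_primitive_of_lower_bound hN hs hc hC hb hK hlow hJ hw)
  · have hc' : Continuous fun t => -f t := hc.neg
    -- The second case is the first for `-f`: the lower bound on `-F` is an upper bound on `F`, and
    -- amplitudes below `1` increase `F(a t) a^(-p)`.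
    have h' : ∀ t : ℝ, t ≠ 0 →
        twoSharp N s * primitive (fun t => -f t) t < -f t * t := by
      intro t ht
      have := h t ht
      rw [primitive_neg]; linarith
    obtain ⟨K, hK, hup⟩ := exists_lower_bound hc' hC (by simpa using hb) h'
    simp_rw [primitive_neg, neg_le_neg_iff] at hup
    set m := (1 / 2 : ℝ) ^ ((N : ℝ) / 2) with hmd
    have hm0 : 0 < m := by positivity
    have hm : m < 1 := Real.rpow_lt_one (by norm_num) (by norm_num) (by positivity)
    have hlt : ∀ t : ℝ, t ≠ 0 → m ^ twoSharp N s * primitive f t < primitive f (m * t) := by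
      intro t ht
      have := primitive_lt_rpow_mul hc' h' ht hm0 hm
      simp_rw [primitive_neg] at this
      linarith
    refine hu0 (eq_zero_of_isMinOn hN hs hr0 (by norm_num : (0 : ℝ) < 1 / 2) hJ hu hmin hlt
      fun w hw hwu hi => ?_)
    obtain ⟨A, hA⟩ := exists_lintegral_rpow_le (s := s) hN hs ‖w‖
    obtain ⟨hi1, -⟩ := integral_abs_rpow (hA w le_rfl) (memHs_iff.1 hw.1)
    have hi2 : Integrable (fun x => K * ((w x) ^ 2 + |w x| ^ twoSharp N s)) :=
      ((integrable_sq w).add hi1).const_mul K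
    have hi3 : Integrable (fun x : Eucl N =>
        m ^ twoSharp N s * |primitive f (u ((1 / 2 : ℝ) • x))|) :=
      ((integrable_comp_smul_iff volume (fun y => |primitive f (u y)|)
        (by norm_num : (1 / 2 : ℝ) ≠ 0)).2 hi.abs).const_mul _
    -- `F(w)` lies between `m^p F(u(x/2))`, integrable because `F(u)` is, and `K (w² + |w|^p)`.
    refine (hi2.add hi3).mono' (aestronglyMeasurable_primitive hc w) ?_
    filter_upwards [hwu] with x hx
    have h1 : m ^ twoSharp N s * primitive f (u ((1 / 2 : ℝ) • x)) ≤ primitive f (w x) := by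
      rw [hx]
      rcases eq_or_ne (u ((1 / 2 : ℝ) • x)) 0 with h0 | h0
      · rw [h0, mul_zero, primitive_zero, mul_zero]
      · exact (hlt _ h0).le
    have h2 := hup (w x)
    have h3 : 0 ≤ m ^ twoSharp N s := by positivity
    have h4 : 0 ≤ K * ((w x) ^ 2 + |w x| ^ twoSharp N s) := by positivity
    have h5 := mul_le_mul_of_nonneg_left (neg_abs_le (primitive f (u ((1 / 2 : ℝ) • x)))) h3
    have h6 := mul_nonneg h3 (abs_nonneg (primitive f (u ((1 / 2 : ℝ) • x))))
    rw [Real.norm_eq_abs, abs_le, Pi.add_apply]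
    constructor <;> linarith
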